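/- Let $R$ be a commutative unital ring, $\Gamma$ a discrete group with identity $\epsilon$, and $G$ an ample Hausdorff groupoid, i.e. a Hausdorff topological groupoid with a basis of compact open bisections. An open bisection is an open set $B\subseteq G$ such that $r(B)$ and $s(B)$ are open and $r|_B$, $s|_B$ are homeomorphisms onto their images. A discrete $R$-twist over $G$ is a topological groupoid $\Sigma$ with continuous groupoid homomorphisms $G^{(0)}\times R^\times\xrightarrow{i}\Sigma\xrightarrow{q}G$, where $R^\times$ is discrete and $G^{(0)}\times R^\times$ is the trivial group bundle, such that: $\Sigma^{(0)}=i(G^{(0)}\times\{1\})$, and $i$, $q$ restrict to homeomorphisms of unit spaces; $i$ is injective, $q$ is surjective and $i(\{x\}\times R^\times)=q^{-1}(x)$ for $x\in G^{(0)}$; every $\alpha\in G$ lies in an open bisection $B$ of $G$ admitting a continuous section $P:B\to\Sigma$ of $q$ for which $(\beta,t)\mapsto i(r(\beta),t)P(\beta)$ is a homeomorphism $B\times R^\times\to q^{-1}(B)$; and $i(r(\sigma),t)\,\sigma=\sigma\, i(s(\sigma),t)$ for all $\sigma\in\Sigma$, $t\in R^\times$ (units of $\Sigma$ and $G$ being identified).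 It is $\Gamma$-graded if it comes with continuous homomorphisms $c_\Sigma:\Sigma\to\Gamma$ and $c_G:G\to\Gamma$ with $c_G\circ q=c_\Sigma$. Put $G_\gamma=c_G^{-1}(\gamma)$ and $\Sigma_\gamma=c_\Sigma^{-1}(\gamma)$; restricting $i$ and $q$ makes $\Sigma_\epsilon$ a discrete $R$-twist over the ample Hausdorff groupoid $G_\epsilon$. The twisted Steinberg algebra $A_R(G;\Sigma)$ consists of the locally constant functions $f:\Sigma\to R$ such that $f(i(r(\sigma),t)\sigma)=t^{-1}f(\sigma)$ for all $\sigma\in\Sigma$, $t\in R^\times$, and such that $\mathrm{supp}_G(f):=q(\{\sigma: f(\sigma)\neq0\})$ is compact. Its operations are pointwise addition and scalar multiplication, and the product $$(f*g)(\sigma)=\sum_{\alpha\in G,\ r(\alpha)=r(q(\sigma)),\ \alpha\in\mathrm{supp}_G(f)} f(S(\alpha))\,g(S(\alpha)^{-1}\sigma),$$ where $S$ is any (not necessarily continuous) section of $q$. Its diagonal is $\{f\in A_R(G;\Sigma):\mathrm{supp}_G(f)\subseteq G^{(0)}\}$, which is $A_R(G^{(0)};q^{-1}(G^{(0)}))$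 with functions extended by zero. An element $n$ of an algebra $A$ is a normaliser of a commutative subalgebra $C$ if there is $m\in A$ with $mnm=m$, $nmn=n$ and $mCn\cup nCm\subseteq C$. The twist $(\Sigma,i,q)$ over $G$ satisfies the local bisection hypothesis if $\mathrm{supp}_G(n)$ is an open bisection of $G$ for every normaliser $n$ of the diagonal in $A_R(G;\Sigma)$. Suppose that $\Sigma$ is a $\Gamma$-graded discrete $R$-twist over $G$ such that the twist $\Sigma_\epsilon$ over $G_\epsilon$ satisfies the local bisection hypothesis. Let $n$ be a homogeneous normaliser of the diagonal $C$ of $A=A_R(G;\Sigma)$, that is, a normaliser of $C$ in $A$ such that $\mathrm{supp}_G(n)\subseteq G_\gamma$ for some $\gamma\in\Gamma$. Then $\mathrm{supp}_G(n)$ is an open bisection of $G$. -/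

import Mathlib

open Set Topology

/-- A groupoid, seen as its set of arrows with a partially defined multiplication: a set `G` with a
set of composable pairs, a product of composable pairs and an inverse.  Only the values `a * b` at
composable pairs `(a, b)` are meaningful: every axiom and every definition below uses the product at
composable pairs only. -/
class ArrowGroupoid (G : Type*) extends Mul G, Inv G where
  /-- `(a, b)` is a composable pair. -/
  Composable : G → G → Prop
  inv_inv' : ∀ a : G, (a⁻¹)⁻¹ = a
  composable_mul_left : ∀ {a b c : G}, Composable a b → Composable b c → Composable (a * b) c
  composable_mul_right : ∀ {a b c : G}, Composable a b → Composable b c → Composable a (b * c)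
  mul_assoc' : ∀ {a b c : G}, Composable a b → Composable b c → (a * b) * c = a * (b * c)
  composable_inv : ∀ a : G, Composable a a⁻¹
  inv_mul_cancel_left' : ∀ {a b : G}, Composable a b → a⁻¹ * (a * b) = b
  mul_inv_cancel_right' : ∀ {a b : G}, Composable a b → (a * b) * b⁻¹ = a

namespace ArrowGroupoid

section Basic

variable {G : Type*} [ArrowGroupoid G]

/-- The source map `s(a) = a⁻¹ a`. -/
def src (a : G) : G := a⁻¹ * a

/-- The range map `r(a) = a a⁻¹`. -/
def rng (a : G) : G := a * a⁻¹

variable (G) in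
/-- The unit space `G⁽⁰⁾ = s(G)`. -/
def unitSpace : Set G := Set.range (src : G → G)

theorem inv_composable (a : G) : Composable a⁻¹ a := by
  have h := composable_inv (a⁻¹)
  rwa [inv_inv'] at h

theorem src_mem (a : G) : src a ∈ unitSpace G := ⟨a, rfl⟩

theorem rng_mem (a : G) : rng a ∈ unitSpace G :=
  ⟨a⁻¹, by simp only [src, rng, inv_inv']⟩

/-- The source, as an element of the unit space. -/
def srcU (a : G) : unitSpace G := ⟨src a, src_mem a⟩

/-- The range, as an element of the unit space. -/
def rngU (a : G) : unitSpace G := ⟨rng a, rng_mem a⟩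

theorem mul_src (a : G) : a * src a = a := by
  have h := inv_mul_cancel_left' (inv_composable a)
  rwa [inv_inv'] at h

theorem rng_mul (a : G) : rng a * a = a := by
  have h := mul_inv_cancel_right' (composable_inv a)
  rwa [inv_inv'] at h

theorem composable_src (a : G) : Composable a (src a) :=
  composable_mul_right (composable_inv a) (inv_composable a)

theorem composable_rng (a : G) : Composable (rng a) a :=
  composable_mul_left (composable_inv a) (inv_composable a)

theorem unit_composable {x : G} (hx : x ∈ unitSpace G) : Composable x x := by
  obtain ⟨a, rfl⟩ := hx
  exact composable_mul_left (inv_composable a) (composable_src a)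

theorem unit_mul_self {x : G} (hx : x ∈ unitSpace G) : x * x = x := by
  obtain ⟨a, rfl⟩ := hx
  have h := mul_assoc' (inv_composable a) (composable_src a)
  rwa [mul_src] at h

theorem src_eq_self {x : G} (hx : x ∈ unitSpace G) : src x = x := by
  have h := inv_mul_cancel_left' (unit_composable hx)
  rwa [unit_mul_self hx] at h

theorem eq_rng_of_composable {x b : G} (hx : x ∈ unitSpace G) (h : Composable x b) :
    x = rng b := by
  have hxx := unit_composable hx
  have h1 := inv_mul_cancel_left' (composable_mul_right hxx h)
  rw [← mul_assoc' hxx h, unit_mul_self hx, inv_mul_cancel_left' h] at h1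
  have h2 := mul_inv_cancel_right' h
  rw [← h1] at h2
  exact h2.symm

theorem eq_src_of_composable {x b : G} (hx : x ∈ unitSpace G) (h : Composable b x) :
    x = src b := by
  have hxx := unit_composable hx
  have h1 := mul_inv_cancel_right' (composable_mul_left h hxx)
  rw [mul_assoc' h hxx, unit_mul_self hx, mul_inv_cancel_right' h] at h1
  have h2 := inv_mul_cancel_left' h
  rw [← h1] at h2
  exact h2.symm

end Basic

section Topological

/-- Inversion is continuous, and so is composition on the space of composable pairs. -/
class IsTopologicalGroupoid (G : Type*) [TopologicalSpace G] [ArrowGroupoid G] : Prop where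
  continuous_inv' : Continuous fun a : G => a⁻¹
  continuousOn_mul : ContinuousOn (fun p : G × G => p.1 * p.2) {p | Composable p.1 p.2}

/-- `B` is an open bisection: `B`, `r(B)` and `s(B)` are open and `r|_B`, `s|_B` are homeomorphisms
onto their images. -/
structure IsOpenBisection {G : Type*} [TopologicalSpace G] [ArrowGroupoid G] (B : Set G) :
    Prop where
  isOpen : IsOpen B
  isOpen_rng : IsOpen (rng '' B)
  isOpen_src : IsOpen (src '' B)
  rng_embedding : IsEmbedding (B.domRestrict rng)
  src_embedding : IsEmbedding (B.domRestrict src)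

/-- A topological groupoid is ample if it has a basis of compact open bisections. -/
class IsAmple (G : Type*) [TopologicalSpace G] [ArrowGroupoid G] : Prop
    extends IsTopologicalGroupoid G where
  basis : TopologicalSpace.IsTopologicalBasis {B : Set G | IsCompact B ∧ IsOpenBisection B}

/-- A `Γ`-grading of `G`: a continuous groupoid homomorphism `G → Γ`. -/
structure Grading (G Γ : Type*) [TopologicalSpace G] [ArrowGroupoid G] [TopologicalSpace Γ]
    [Group Γ] where
  toFun : G → Γ
  continuous_toFun : Continuous toFun
  map_mul' : ∀ {a b : G}, Composable a b → toFun (a * b) = toFun a * toFun b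

namespace Grading

variable {G Γ : Type*} [TopologicalSpace G] [ArrowGroupoid G] [TopologicalSpace Γ] [Group Γ]

/-- The set `G_γ` of arrows of degree `γ`. -/
def fibre (c : Grading G Γ) (γ : Γ) : Set G := {a | c.toFun a = γ}

theorem map_src (c : Grading G Γ) (a : G) : c.toFun (src a) = 1 := by
  have h1 := c.map_mul' (composable_src a)
  rw [mul_src] at h1
  simpa using h1

theorem map_unit (c : Grading G Γ) {x : G} (hx : x ∈ unitSpace G) : c.toFun x = 1 := by
  obtain ⟨a, rfl⟩ := hx
  exact c.map_src a

theorem map_inv (c : Grading G Γ) (a : G) : c.toFun a⁻¹ = (c.toFun a)⁻¹ := by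
  have h := c.map_src a
  rw [src, c.map_mul' (inv_composable a)] at h
  exact eq_inv_of_mul_eq_one_left h

open Classical in
/-- The product of the subgroupoid `G_ε`. Off the composable pairs its value is a meaningless
default. -/
noncomputable def kerMul (c : Grading G Γ) (a b : c.fibre 1) : c.fibre 1 :=
  if h : Composable (a : G) (b : G) then
    ⟨(a : G) * (b : G), by
      have ha : c.toFun a = 1 := a.2
      have hb : c.toFun b = 1 := b.2
      change c.toFun _ = 1
      rw [c.map_mul' h, ha, hb, one_mul]⟩ else a

theorem coe_kerMul (c : Grading G Γ) {a b : c.fibre 1} (h : Composable (a : G) (b : G)) :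
    (c.kerMul a b : G) = (a : G) * (b : G) := by
  rw [kerMul, dif_pos h]

/-- The subgroupoid `G_ε` of arrows of degree `ε`. -/
noncomputable instance (c : Grading G Γ) : ArrowGroupoid (c.fibre 1) where
  Composable a b := Composable (a : G) (b : G)
  mul := c.kerMul
  inv a := ⟨(a : G)⁻¹, by
    have ha : c.toFun a = 1 := a.2
    change c.toFun _ = 1
    rw [c.map_inv, ha, inv_one]⟩
  inv_inv' a := Subtype.ext (inv_inv' _)
  composable_mul_left := by
    intro a b d h1 h2
    change Composable (c.kerMul a b : G) (d : G)
    rw [coe_kerMul c h1]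
    exact composable_mul_left h1 h2
  composable_mul_right := by
    intro a b d h1 h2
    change Composable (a : G) (c.kerMul b d : G)
    have e := coe_kerMul c h2
    have h3 : Composable (a : G) ((b : G) * (d : G)) := composable_mul_right h1 h2
    rwa [← e] at h3
  mul_assoc' := by
    intro a b d h1 h2
    apply Subtype.ext
    change (c.kerMul (c.kerMul a b) d : G) = c.kerMul a (c.kerMul b d)
    have e1 := coe_kerMul c h1
    have e2 := coe_kerMul c h2
    have h3 : Composable (c.kerMul a b : G) (d : G) := by
      rw [e1]
      exact composable_mul_left h1 h2
    have h4 : Composable (a : G) (c.kerMul b d : G) := by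
      have h5 : Composable (a : G) ((b : G) * (d : G)) := composable_mul_right h1 h2
      rwa [← e2] at h5
    have e3 := coe_kerMul c h3
    have e4 := coe_kerMul c h4
    rw [e1] at e3
    rw [e2] at e4
    exact e3.trans ((mul_assoc' h1 h2).trans e4.symm)
  composable_inv a := composable_inv _
  inv_mul_cancel_left' := by
    intro a b h
    apply Subtype.ext
    change (c.kerMul _ (c.kerMul a b) : G) = b
    rw [coe_kerMul c (by rw [coe_kerMul c h]; exact composable_mul_right (inv_composable _) h),
      coe_kerMul c h]
    exact inv_mul_cancel_left' h
  mul_inv_cancel_right' := by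
    intro a b h
    apply Subtype.ext
    change (c.kerMul (c.kerMul a b) _ : G) = a
    rw [coe_kerMul c (by rw [coe_kerMul c h]; exact composable_mul_left h (composable_inv _)),
      coe_kerMul c h]
    exact mul_inv_cancel_right' h

variable (c : Grading G Γ)

theorem coe_mul {a b : c.fibre 1} (h : Composable (a : G) (b : G)) :
    ((a * b : c.fibre 1) : G) = (a : G) * (b : G) := c.coe_kerMul h

theorem coe_inv (a : c.fibre 1) : ((a⁻¹ : c.fibre 1) : G) = (a : G)⁻¹ := rfl

theorem coe_src (a : c.fibre 1) : ((src a : c.fibre 1) : G) = src (a : G) :=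
  c.coe_mul (a := a⁻¹) (b := a) (inv_composable (a : G))

theorem coe_rng (a : c.fibre 1) : ((rng a : c.fibre 1) : G) = rng (a : G) :=
  c.coe_mul (a := a) (b := a⁻¹) (composable_inv (a : G))

theorem mem_unitSpace_iff (x : c.fibre 1) :
    x ∈ unitSpace (c.fibre 1) ↔ (x : G) ∈ unitSpace G := by
  constructor
  · rintro ⟨a, rfl⟩
    rw [coe_src]
    exact src_mem _
  · intro hx
    exact ⟨x, Subtype.ext (by rw [coe_src, src_eq_self hx])⟩

instance [IsTopologicalGroupoid G] : IsTopologicalGroupoid (c.fibre 1) where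
  continuous_inv' := by
    refine Continuous.subtype_mk ?_ _
    exact IsTopologicalGroupoid.continuous_inv'.comp continuous_subtype_val
  continuousOn_mul := by
    rw [IsInducing.subtypeVal.continuousOn_iff]
    have h : ContinuousOn (fun p : c.fibre 1 × c.fibre 1 => (p.1 : G) * (p.2 : G))
        {p | Composable p.1 p.2} :=
      (IsTopologicalGroupoid.continuousOn_mul (G := G)).comp
        (f := fun p : c.fibre 1 × c.fibre 1 => ((p.1 : G), (p.2 : G)))
        (by fun_prop) (fun p hp => hp)
    exact h.congr fun p hp => c.coe_mul hp

theorem isOpen_image_coe [DiscreteTopology Γ] {f : G → G} {B : Set G} {g : c.fibre 1 → c.fibre 1}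
    (hg : ∀ a, (g a : G) = f a) (hfB : IsOpen (f '' B)) (he : IsEmbedding (B.domRestrict f)) :
    IsOpen (g '' (Subtype.val ⁻¹' B)) := by
  have ho : IsOpenEmbedding (B.domRestrict f) := ⟨he, by rwa [Set.range_domRestrict]⟩
  have hK : IsOpen (c.fibre 1) := (isOpen_discrete {(1 : Γ)}).preimage c.continuous_toFun
  have h1 := ho.isOpenMap _ (hK.preimage (continuous_subtype_val (p := fun x => x ∈ B)))
  convert h1.preimage (continuous_subtype_val (p := fun x => x ∈ c.fibre 1)) using 1
  ext y
  constructor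
  · rintro ⟨a, ha, rfl⟩
    exact ⟨⟨a, ha⟩, a.2, (hg a).symm⟩
  · rintro ⟨⟨b, hb⟩, hb', h⟩
    exact ⟨⟨b, hb'⟩, hb, Subtype.ext (by rw [hg]; exact h)⟩

theorem isEmbedding_coe {f : G → G} {B : Set G} {g : c.fibre 1 → c.fibre 1}
    (hg : ∀ a, (g a : G) = f a) (he : IsEmbedding (B.domRestrict f)) :
    IsEmbedding ((Subtype.val ⁻¹' B : Set (c.fibre 1)).domRestrict g) := by
  have hj : IsEmbedding
      (fun a : (Subtype.val ⁻¹' B : Set (c.fibre 1)) => (⟨(a : c.fibre 1), a.2⟩ : B)) :=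
    (IsEmbedding.subtypeVal.comp IsEmbedding.subtypeVal).codRestrict B fun a => a.2
  have h := he.comp hj
  have h2 : B.domRestrict f ∘ (fun a : (Subtype.val ⁻¹' B : Set (c.fibre 1)) =>
      (⟨(a : c.fibre 1), a.2⟩ : B)) = Subtype.val ∘ (Subtype.val ⁻¹' B).domRestrict g := by
    funext a
    exact (hg a).symm
  rw [h2] at h
  exact IsEmbedding.subtypeVal.of_comp_iff.mp h

theorem isOpenBisection_preimage [DiscreteTopology Γ] {B : Set G} (hB : IsOpenBisection B) :
    IsOpenBisection (Subtype.val ⁻¹' B : Set (c.fibre 1)) where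
  isOpen := hB.isOpen.preimage continuous_subtype_val
  isOpen_rng := c.isOpen_image_coe c.coe_rng hB.isOpen_rng hB.rng_embedding
  isOpen_src := c.isOpen_image_coe c.coe_src hB.isOpen_src hB.src_embedding
  rng_embedding := c.isEmbedding_coe c.coe_rng hB.rng_embedding
  src_embedding := c.isEmbedding_coe c.coe_src hB.src_embedding

end Grading

end Topological

end ArrowGroupoid

open ArrowGroupoid

/-- The unit group of `R` carries the discrete topology. -/
@[reducible]
def discreteUnits (R : Type*) [CommRing R] : TopologicalSpace Rˣ := ⊥

attribute [local instance] discreteUnits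

/-- A discrete `R`-twist `G⁽⁰⁾ × Rˣ --i--> S --q--> G` over `G`. A map is a homeomorphism of `X` onto
a subset `Y` of its codomain exactly if it is an embedding with range `Y`. -/
structure DiscreteTwist (R S G : Type*) [CommRing R]
    [TopologicalSpace S] [ArrowGroupoid S] [IsTopologicalGroupoid S]
    [TopologicalSpace G] [ArrowGroupoid G] [IsTopologicalGroupoid G] where
  i : unitSpace G × Rˣ → S
  q : S → G
  continuous_i : Continuous i
  continuous_q : Continuous q
  /-- `i` is a homomorphism on the trivial group bundle `G⁽⁰⁾ × Rˣ`. -/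
  i_composable : ∀ (x : unitSpace G) (t u : Rˣ), Composable (i (x, t)) (i (x, u))
  i_mul : ∀ (x : unitSpace G) (t u : Rˣ), i (x, t) * i (x, u) = i (x, t * u)
  /-- `q` is a homomorphism. -/
  q_composable : ∀ {a b : S}, Composable a b → Composable (q a) (q b)
  q_mul : ∀ {a b : S}, Composable a b → q (a * b) = q a * q b
  /-- `i` maps `G⁽⁰⁾ × {1}` homeomorphically onto `S⁽⁰⁾`. -/
  i_unit_range : Set.range (fun x : unitSpace G => i (x, 1)) = unitSpace S
  i_unit_embedding : IsEmbedding fun x : unitSpace G => i (x, 1)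
  /-- `q` maps `S⁽⁰⁾` homeomorphically onto `G⁽⁰⁾`. -/
  q_unit_image : q '' unitSpace S = unitSpace G
  q_unit_embedding : IsEmbedding ((unitSpace S).domRestrict q)
  /-- Exactness. -/
  exact : ∀ x : unitSpace G, Set.range (fun t : Rˣ => i (x, t)) = q ⁻¹' {(x : G)}
  i_injective : Function.Injective i
  q_surjective : Function.Surjective q
  /-- Local triviality. -/
  locally_trivial : ∀ a : G, ∃ B : Set G, IsOpenBisection B ∧ a ∈ B ∧
    ∃ P : B → S, Continuous P ∧ (∀ b : B, q (P b) = b) ∧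
      IsEmbedding (fun p : B × Rˣ => i (rngU (p.1 : G), p.2) * P p.1) ∧
      Set.range (fun p : B × Rˣ => i (rngU (p.1 : G), p.2) * P p.1) = q ⁻¹' B
  /-- Centrality, where `S⁽⁰⁾` is identified with `G⁽⁰⁾` through `q`. -/
  central : ∀ (a : S) (t : Rˣ), i (rngU (q a), t) * a = a * i (srcU (q a), t)

namespace DiscreteTwist

section

variable {R S G : Type*} [CommRing R]
    [TopologicalSpace S] [ArrowGroupoid S] [IsTopologicalGroupoid S]
    [TopologicalSpace G] [ArrowGroupoid G] [IsTopologicalGroupoid G]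
    (W : DiscreteTwist R S G)

/-- The action `t · σ = i(r(σ), t) σ` of `Rˣ` on `S`. -/
def act (t : Rˣ) (a : S) : S := W.i (rngU (W.q a), t) * a

/-- `supp_G(f) = q(supp f)`. -/
def suppG (f : S → R) : Set G := W.q '' Function.support f

/-- The (underlying set of the) twisted Steinberg algebra `A_R(G; S)`: the locally constant,
`Rˣ`-contravariant functions `f : S → R` with `supp_G(f)` compact. Addition and scalar multiplication
are pointwise; the product is `conv`. -/
def steinbergAlgebra : Set (S → R) :=
  {f | IsLocallyConstant f ∧ (∀ (t : Rˣ) (a : S), f (W.act t a) = ((t⁻¹ : Rˣ) : R) * f a) ∧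
    IsCompact (W.suppG f)}

/-- A section of `q`, not continuous in general; on `steinbergAlgebra` the product `conv` does not
depend on its choice. -/
noncomputable def sec : G → S := Function.surjInv W.q_surjective

/-- The convolution product. For `f` in `steinbergAlgebra` and `G` ample Hausdorff the sum is finite. -/
noncomputable def conv (f g : S → R) : S → R := fun a =>
  ∑ᶠ α ∈ {α : G | rng α = rng (W.q a)} ∩ W.suppG f, f (W.sec α) * g ((W.sec α)⁻¹ * a)

/-- The diagonal `A_R(G⁽⁰⁾; q⁻¹(G⁽⁰⁾))`, whose elements, functions on `q⁻¹(G⁽⁰⁾)`, are extended by zero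
to `S`: the elements of `A_R(G; S)` that are supported on `q⁻¹(G⁽⁰⁾)`. -/
def diagonal : Set (S → R) := {f | f ∈ W.steinbergAlgebra ∧ W.suppG f ⊆ unitSpace G}

/-- `n` is a normaliser of the diagonal in `A_R(G; S)`. -/
def IsNormaliser (n : S → R) : Prop :=
  n ∈ W.steinbergAlgebra ∧ ∃ m ∈ W.steinbergAlgebra,
    W.conv (W.conv m n) m = m ∧ W.conv (W.conv n m) n = n ∧
    (∀ f ∈ W.diagonal, W.conv (W.conv m f) n ∈ W.diagonal) ∧
    (∀ f ∈ W.diagonal, W.conv (W.conv n f) m ∈ W.diagonal)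

/-- The local bisection hypothesis. -/
def LocalBisectionHypothesis : Prop :=
  ∀ n : S → R, W.IsNormaliser n → IsOpenBisection (W.suppG n)

end

end DiscreteTwist

/-- A `Γ`-graded discrete `R`-twist over `G`. -/
structure GradedDiscreteTwist (R Γ S G : Type*) [CommRing R] [TopologicalSpace Γ] [Group Γ]
    [TopologicalSpace S] [ArrowGroupoid S] [IsTopologicalGroupoid S]
    [TopologicalSpace G] [ArrowGroupoid G] [IsTopologicalGroupoid G]
    extends DiscreteTwist R S G where
  cS : Grading S Γ
  cG : Grading G Γ
  comm : ∀ a : S, cG.toFun (q a) = cS.toFun a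

namespace GradedDiscreteTwist

section

variable {R Γ S G : Type*} [CommRing R] [TopologicalSpace Γ] [Group Γ]
    [TopologicalSpace S] [ArrowGroupoid S] [IsTopologicalGroupoid S]
    [TopologicalSpace G] [ArrowGroupoid G] [IsTopologicalGroupoid G]
    (W : GradedDiscreteTwist R Γ S G)

/-- The homogeneous component `A_R(G; S)_γ`. -/
def component (γ : Γ) : Set (S → R) :=
  {f | f ∈ W.steinbergAlgebra ∧ W.suppG f ⊆ W.cG.fibre γ}

/-- `n` is a homogeneous normaliser of the diagonal. -/
def IsHomogeneousNormaliser (n : S → R) : Prop :=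
  W.IsNormaliser n ∧ ∃ γ : Γ, n ∈ W.component γ

/-- The inclusion `G_ε⁽⁰⁾ → G⁽⁰⁾`. -/
def unitIncl (x : unitSpace (W.cG.fibre 1)) : unitSpace G :=
  ⟨((x : W.cG.fibre 1) : G), (W.cG.mem_unitSpace_iff _).mp x.2⟩

theorem q_i (x : unitSpace G) (t : Rˣ) : W.q (W.i (x, t)) = x := by
  have h : W.i (x, t) ∈ W.q ⁻¹' {(x : G)} := by
    rw [← W.exact x]
    exact ⟨t, rfl⟩
  exact h

theorem cS_i (x : unitSpace G) (t : Rˣ) : W.cS.toFun (W.i (x, t)) = 1 := by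
  rw [← W.comm, W.q_i]
  exact W.cG.map_unit x.2

theorem unitIncl_embedding : IsEmbedding W.unitIncl :=
  (IsEmbedding.subtypeVal.comp IsEmbedding.subtypeVal).codRestrict _ _

theorem unitIncl_rngU (a : W.cG.fibre 1) : W.unitIncl (rngU a) = rngU (a : G) :=
  Subtype.ext (W.cG.coe_rng a)

theorem unitIncl_srcU (a : W.cG.fibre 1) : W.unitIncl (srcU a) = srcU (a : G) :=
  Subtype.ext (W.cG.coe_src a)

theorem exists_unitIncl (x : unitSpace G) : ∃ y, W.unitIncl y = x :=
  ⟨⟨⟨x, W.cG.map_unit x.2⟩, (W.cG.mem_unitSpace_iff _).mpr x.2⟩, rfl⟩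

theorem i_one_mem (x : unitSpace G) : W.i (x, 1) ∈ unitSpace S :=
  W.i_unit_range ▸ Set.mem_range_self x

theorem i_one_eq {x : unitSpace G} {u : S} (hu : u ∈ unitSpace S) (h : (x : G) = W.q u) :
    W.i (x, 1) = u := by
  have h1 := @W.q_unit_embedding.injective ⟨_, W.i_one_mem x⟩ ⟨u, hu⟩
    ((W.q_i x 1).trans h)
  exact congrArg Subtype.val h1

theorem q_unit_mem {u : S} (hu : u ∈ unitSpace S) : W.q u ∈ unitSpace G :=
  W.q_unit_image ▸ Set.mem_image_of_mem _ hu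

theorem composable_i_rng (a : S) (t : Rˣ) : Composable (W.i (rngU (W.q a), t)) a := by
  have h1 := eq_rng_of_composable (W.q_unit_mem (rng_mem a)) (W.q_composable (composable_rng a))
  have h2 : W.i (rngU (W.q a), 1) = rng a := W.i_one_eq (rng_mem a) h1.symm
  have h3 := W.i_composable (rngU (W.q a)) t 1
  rw [h2] at h3
  have h4 := composable_mul_right h3 (composable_rng a)
  rwa [rng_mul] at h4

theorem composable_i_src (a : S) (t : Rˣ) : Composable a (W.i (srcU (W.q a), t)) := by
  have h1 := eq_src_of_composable (W.q_unit_mem (src_mem a)) (W.q_composable (composable_src a))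
  have h2 : W.i (srcU (W.q a), 1) = src a := W.i_one_eq (src_mem a) h1.symm
  have h3 := W.i_composable (srcU (W.q a)) 1 t
  rw [h2] at h3
  have h4 := composable_mul_left (composable_src a) h3
  rwa [mul_src] at h4

/-- The twist `G_ε⁽⁰⁾ × Rˣ → S_ε → G_ε` over `G_ε` obtained by restricting `i` and `q`. -/
def identityTwist [DiscreteTopology Γ] :
    DiscreteTwist R (W.cS.fibre 1) (W.cG.fibre 1) where
  i p := ⟨W.i (W.unitIncl p.1, p.2), W.cS_i _ _⟩
  q a := ⟨W.q a, (W.comm a).trans a.2⟩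
  continuous_i := (W.continuous_i.comp
    ((W.unitIncl_embedding.continuous.comp continuous_fst).prodMk continuous_snd)).subtype_mk _
  continuous_q := (W.continuous_q.comp continuous_subtype_val).subtype_mk _
  i_composable x t u := W.i_composable _ t u
  i_mul x t u := Subtype.ext ((W.cS.coe_mul (W.i_composable _ t u)).trans (W.i_mul _ t u))
  q_composable h := W.q_composable h
  q_mul := by
    intro a b h
    apply Subtype.ext
    rw [W.cG.coe_mul (W.q_composable h)]
    change W.q ((a * b : W.cS.fibre 1) : S) = _
    rw [W.cS.coe_mul h]
    exact W.q_mul h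
  i_unit_range := by
    ext y
    rw [W.cS.mem_unitSpace_iff, ← W.i_unit_range]
    constructor
    · rintro ⟨x, rfl⟩
      exact ⟨W.unitIncl x, rfl⟩
    · rintro ⟨x, hx⟩
      obtain ⟨z, rfl⟩ := W.exists_unitIncl x
      exact ⟨z, Subtype.ext hx⟩
  i_unit_embedding :=
    (W.i_unit_embedding.comp W.unitIncl_embedding).codRestrict (W.cS.fibre 1) fun _ => W.cS_i _ _
  q_unit_image := by
    ext y
    rw [W.cG.mem_unitSpace_iff, ← W.q_unit_image]
    constructor
    · rintro ⟨x, hx, rfl⟩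
      exact ⟨x, (W.cS.mem_unitSpace_iff _).mp hx, rfl⟩
    · rintro ⟨x, hx, h⟩
      exact ⟨⟨x, W.cS.map_unit hx⟩, (W.cS.mem_unitSpace_iff _).mpr hx, Subtype.ext h⟩
  q_unit_embedding := by
    have hj : IsEmbedding (fun a : unitSpace (W.cS.fibre 1) =>
        (⟨((a : W.cS.fibre 1) : S), (W.cS.mem_unitSpace_iff _).mp a.2⟩ : unitSpace S)) :=
      (IsEmbedding.subtypeVal.comp IsEmbedding.subtypeVal).codRestrict _ _
    exact (W.q_unit_embedding.comp hj).codRestrict (W.cG.fibre 1)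
      fun a => (W.comm _).trans (a : W.cS.fibre 1).2
  exact := by
    intro x
    ext y
    have h := Set.ext_iff.mp (W.exact (W.unitIncl x)) (y : S)
    simp only [Set.mem_range, Set.mem_preimage, Set.mem_singleton_iff] at h ⊢
    constructor
    · rintro ⟨t, ht⟩
      exact Subtype.ext (h.mp ⟨t, congrArg Subtype.val ht⟩)
    · intro hy
      obtain ⟨t, ht⟩ := h.mpr (congrArg Subtype.val hy)
      exact ⟨t, Subtype.ext ht⟩
  i_injective := by
    rintro ⟨x, t⟩ ⟨y, u⟩ h
    have h2 := W.i_injective (congrArg Subtype.val h)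
    rw [Prod.mk.injEq] at h2
    exact Prod.ext (W.unitIncl_embedding.injective h2.1) h2.2
  q_surjective := by
    intro y
    obtain ⟨x, hx⟩ := W.q_surjective y
    exact ⟨⟨x, (W.comm x).symm.trans ((congrArg _ hx).trans y.2)⟩, Subtype.ext hx⟩
  locally_trivial := by
    intro a
    obtain ⟨B, hB, ha, P, hP, hqP, hemb, hran⟩ := W.locally_trivial a
    have hPmem : ∀ b : (Subtype.val ⁻¹' B : Set (W.cG.fibre 1)),
        P ⟨(b : W.cG.fibre 1), b.2⟩ ∈ W.cS.fibre 1 := fun b => by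
      change W.cS.toFun _ = 1
      rw [← W.comm, hqP]
      exact (b : W.cG.fibre 1).2
    have hj : IsEmbedding
        (fun b : (Subtype.val ⁻¹' B : Set (W.cG.fibre 1)) => (⟨(b : W.cG.fibre 1), b.2⟩ : B)) :=
      (IsEmbedding.subtypeVal.comp IsEmbedding.subtypeVal).codRestrict B fun b => b.2
    have key : ∀ p : (Subtype.val ⁻¹' B : Set (W.cG.fibre 1)) × Rˣ,
        (((⟨W.i (W.unitIncl (rngU (p.1 : W.cG.fibre 1)), p.2), W.cS_i _ _⟩ : W.cS.fibre 1) *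
          (⟨P ⟨(p.1 : W.cG.fibre 1), p.1.2⟩, hPmem p.1⟩ : W.cS.fibre 1) : W.cS.fibre 1) : S) =
        W.i (rngU ((p.1 : W.cG.fibre 1) : G), p.2) * P ⟨(p.1 : W.cG.fibre 1), p.1.2⟩ := by
      rintro ⟨b, t⟩
      have hc := W.composable_i_rng (P ⟨(b : W.cG.fibre 1), b.2⟩) t
      rw [hqP] at hc
      rw [W.cS.coe_mul (by rw [W.unitIncl_rngU]; exact hc)]
      simp only [W.unitIncl_rngU]
    refine ⟨Subtype.val ⁻¹' B, W.cG.isOpenBisection_preimage hB, ha,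
      fun b => ⟨P ⟨(b : W.cG.fibre 1), b.2⟩, hPmem b⟩,
      (hP.comp hj.continuous).subtype_mk _, fun b => Subtype.ext (hqP _), ?_, ?_⟩
    · have h := hemb.comp (hj.prodMap (IsEmbedding.id (X := Rˣ)))
      refine IsEmbedding.subtypeVal.of_comp_iff.mp ?_
      convert h using 1
      funext p
      exact key p
    · ext y
      have h := Set.ext_iff.mp hran (y : S)
      simp only [Set.mem_range, Set.mem_preimage] at h ⊢
      constructor
      · rintro ⟨p, hp⟩
        exact h.mp ⟨(⟨(p.1 : W.cG.fibre 1), p.1.2⟩, p.2),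
          (key p).symm.trans (congrArg Subtype.val hp)⟩
      · intro hy
        obtain ⟨⟨b, t⟩, hp⟩ := h.mpr hy
        have hb : (b : G) ∈ W.cG.fibre 1 := by
          have h1 := congrArg W.q hp
          have hc := W.composable_i_rng (P b) t
          rw [hqP] at hc
          have h2 := congrArg W.cG.toFun h1
          rw [W.q_mul hc, W.cG.map_mul' (W.q_composable hc), W.q_i, hqP,
            W.cG.map_unit (rngU (b : G)).2, one_mul, W.comm] at h2
          exact h2.trans y.2
        exact ⟨(⟨⟨b, hb⟩, b.2⟩, t), Subtype.ext ((key _).trans hp)⟩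
  central := by
    intro a t
    apply Subtype.ext
    have h1 : Composable (W.i (W.unitIncl (rngU ⟨W.q a, (W.comm a).trans a.2⟩), t)) (a : S) := by
      rw [W.unitIncl_rngU]
      exact W.composable_i_rng a t
    have h2 : Composable (a : S) (W.i (W.unitIncl (srcU ⟨W.q a, (W.comm a).trans a.2⟩), t)) := by
      rw [W.unitIncl_srcU]
      exact W.composable_i_src a t
    refine (W.cS.coe_mul h1).trans (Eq.trans ?_ (W.cS.coe_mul h2).symm)
    simp only [W.unitIncl_rngU, W.unitIncl_srcU]
    exact W.central a t

end

end GradedDiscreteTwist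

/-! The homogeneous normaliser is moved into degree `ε`. Its support is open because `q` is an open
map, and in an ample groupoid an open set is an open bisection as soon as `r` and `s` are injective
on it. So let `n` have degree `γ` and let `α`, `β` in its support have the same range. Choose a
compact open bisection `B ⊆ G_{γ⁻¹}` containing `α⁻¹` over which the twist is trivial, and let `b`
be the function equal to `1` along a local section over `B` (`bump`). Then `b` is a normaliser, and
so is `b * n`, which has degree `ε`. Its restriction to `Σ_ε` normalises the diagonal there, so by
hypothesis its support is a bisection.

Since `B` is a bisection, no cancellation occurs in `b * n`: both `α⁻¹α` and `α⁻¹β` lie in its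
support (`IsChart.mul_mem_suppG_left`). They have the same range, hence are equal, and `α = β`. For
sources, `n * b` is used in the same way.

Three points carry the weight. The algebra is a semigroup under convolution (`conv_assoc`,
`conv_mem`). Products of normalisers are normalisers (`IsNormaliserPair.mul`), because `nm` and `mn`
lie in the commutative diagonal; this membership comes from local units (`exists_local_unit`).
Finally, restriction to degree `ε` respects every product that occurs, although the quasi-inverse of
a normaliser is not known to be homogeneous (`isNormaliser_res`). -/

namespace ArrowGroupoid

/-! ### Arrow calculus in a groupoid -/

section Algebra

variable {G : Type*} [ArrowGroupoid G]

/-- The only unit composable with `b` on its left is `rng b`. This turns composability into an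
equation that can be rewritten. -/
theorem composable_iff {a b : G} : Composable a b ↔ src a = rng b := by
  constructor
  · intro h
    exact eq_rng_of_composable (src_mem a) (composable_mul_left (inv_composable a) h)
  · intro h
    have h1 := composable_rng b
    rw [← h] at h1
    have h2 := composable_mul_right (composable_src a) h1
    rwa [h, rng_mul] at h2

theorem src_inv (a : G) : src a⁻¹ = rng a := by simp only [src, rng, inv_inv']

theorem rng_inv (a : G) : rng a⁻¹ = src a := by simp only [src, rng, inv_inv']

theorem rng_eq_self {x : G} (hx : x ∈ unitSpace G) : rng x = x :=
  (eq_rng_of_composable hx (unit_composable hx)).symm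

theorem rng_rng (a : G) : rng (rng a) = rng a := rng_eq_self (rng_mem a)

theorem rng_mul_eq {a b : G} (h : src a = rng b) : rng (a * b) = rng a :=
  (eq_rng_of_composable (rng_mem a)
    (composable_mul_right (composable_rng a) (composable_iff.mpr h))).symm

theorem src_mul_eq {a b : G} (h : src a = rng b) : src (a * b) = src b :=
  (eq_src_of_composable (src_mem b)
    (composable_mul_left (composable_iff.mpr h) (composable_src b))).symm

theorem mul_assoc_of_eq {a b c : G} (h : src a = rng b) (h' : src b = rng c) :
    a * b * c = a * (b * c) :=
  mul_assoc' (composable_iff.mpr h) (composable_iff.mpr h')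

theorem inv_mul_cancel_left_of_eq {a b : G} (h : src a = rng b) : a⁻¹ * (a * b) = b :=
  inv_mul_cancel_left' (composable_iff.mpr h)

theorem mul_inv_cancel_left_of_eq {a b : G} (h : rng a = rng b) : a * (a⁻¹ * b) = b := by
  have h1 := inv_mul_cancel_left_of_eq (a := a⁻¹) (b := b) (by rw [src_inv, h])
  rwa [inv_inv'] at h1

theorem mul_inv_cancel_right_of_eq {a b : G} (h : src a = rng b) : a * b * b⁻¹ = a :=
  mul_inv_cancel_right' (composable_iff.mpr h)

theorem rng_inv_mul {a b : G} (h : rng a = rng b) : rng (a⁻¹ * b) = src a := by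
  rw [rng_mul_eq (by rw [src_inv, h]), rng_inv]

theorem mul_inv_rev_of_eq {a b : G} (h : src a = rng b) : (a * b)⁻¹ = b⁻¹ * a⁻¹ := by
  have h1 : a⁻¹ * (a * b) * (a * b)⁻¹ = a⁻¹ :=
    mul_inv_cancel_right_of_eq (by rw [src_inv, rng_mul_eq h])
  rw [inv_mul_cancel_left_of_eq h] at h1
  rw [← h1, inv_mul_cancel_left_of_eq (by rw [rng_inv, src_mul_eq h])]

theorem inv_unit {x : G} (hx : x ∈ unitSpace G) : x⁻¹ = x := by
  have h := mul_src x⁻¹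
  rw [src_inv, rng_eq_self hx] at h
  rw [← h]
  exact src_eq_self hx

theorem mul_left_cancel_of_eq {a b c : G} (h : src a = rng b) (h' : src a = rng c)
    (e : a * b = a * c) : b = c := by
  rw [← inv_mul_cancel_left_of_eq h, e, inv_mul_cancel_left_of_eq h']

theorem mul_right_cancel_of_eq {a b c : G} (h : src a = rng c) (h' : src b = rng c)
    (e : a * c = b * c) : a = b := by
  rw [← mul_inv_cancel_right_of_eq h, e, mul_inv_cancel_right_of_eq h']

/-- Left multiplication by `b`, between the fibres of the range map over `s(b)` and `r(b)`. -/
def mulLeftEquiv (b : G) : {a : G // rng a = src b} ≃ {a : G // rng a = rng b} where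
  toFun a := ⟨b * a, rng_mul_eq a.2.symm⟩
  invFun a := ⟨b⁻¹ * a, rng_inv_mul a.2.symm⟩
  left_inv a := Subtype.ext (inv_mul_cancel_left_of_eq a.2.symm)
  right_inv a := Subtype.ext (mul_inv_cancel_left_of_eq a.2.symm)

end Algebra

/-! ### Topology of ample groupoids -/

section Topology

variable {G : Type*} [TopologicalSpace G] [ArrowGroupoid G]

theorem continuous_rng [IsTopologicalGroupoid G] : Continuous (rng : G → G) :=
  (IsTopologicalGroupoid.continuousOn_mul (G := G)).comp_continuous
    (continuous_id.prodMk IsTopologicalGroupoid.continuous_inv') composable_inv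

theorem continuous_src [IsTopologicalGroupoid G] : Continuous (src : G → G) :=
  (IsTopologicalGroupoid.continuousOn_mul (G := G)).comp_continuous
    (IsTopologicalGroupoid.continuous_inv'.prodMk continuous_id) inv_composable

theorem IsOpenBisection.injOn_rng {B : Set G} (hB : IsOpenBisection B) : InjOn rng B :=
  Set.injOn_iff_injective.mpr hB.rng_embedding.injective

theorem IsOpenBisection.injOn_src {B : Set G} (hB : IsOpenBisection B) : InjOn src B :=
  Set.injOn_iff_injective.mpr hB.src_embedding.injective

variable [IsAmple G]

theorem exists_compact_openBisection {U : Set G} (hU : IsOpen U) {a : G} (ha : a ∈ U) :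
    ∃ B, IsCompact B ∧ IsOpenBisection B ∧ a ∈ B ∧ B ⊆ U := by
  obtain ⟨B, ⟨h1, h2⟩, h3, h4⟩ := (IsAmple.basis (G := G)).exists_subset_of_mem_open ha hU
  exact ⟨B, h1, h2, h3, h4⟩

theorem isOpenMap_rng : IsOpenMap (rng : G → G) := by
  intro U hU
  rw [isOpen_iff_forall_mem_open]
  rintro _ ⟨a, ha, rfl⟩
  obtain ⟨B, -, hB, haB, hBU⟩ := exists_compact_openBisection hU ha
  exact ⟨rng '' B, image_mono hBU, hB.isOpen_rng, mem_image_of_mem _ haB⟩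

theorem isOpenMap_src : IsOpenMap (src : G → G) := by
  intro U hU
  rw [isOpen_iff_forall_mem_open]
  rintro _ ⟨a, ha, rfl⟩
  obtain ⟨B, -, hB, haB, hBU⟩ := exists_compact_openBisection hU ha
  exact ⟨src '' B, image_mono hBU, hB.isOpen_src, mem_image_of_mem _ haB⟩

/-- In an ample groupoid `r` and `s` are continuous and open, so on an open set injectivity alone
makes them open embeddings. -/
theorem isOpenBisection_of_injOn {B : Set G} (hB : IsOpen B) (hr : InjOn rng B)
    (hs : InjOn src B) : IsOpenBisection B where
  isOpen := hB
  isOpen_rng := isOpenMap_rng _ hB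
  isOpen_src := isOpenMap_src _ hB
  rng_embedding := (IsOpenEmbedding.of_continuous_injective_isOpenMap
    (continuous_rng.comp continuous_subtype_val) (Set.injOn_iff_injective.mp hr)
    (isOpenMap_rng.comp hB.isOpenMap_subtype_val)).isEmbedding
  src_embedding := (IsOpenEmbedding.of_continuous_injective_isOpenMap
    (continuous_src.comp continuous_subtype_val) (Set.injOn_iff_injective.mp hs)
    (isOpenMap_src.comp hB.isOpenMap_subtype_val)).isEmbedding

/-- Finitely many open bisections cover `K`, and each meets a fibre of `r` at most once. This is
what makes convolution sums finite. -/
theorem finite_rng_fibre {K : Set G} (hK : IsCompact K) (x : G) :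
    {a | a ∈ K ∧ rng a = x}.Finite := by
  refine hK.induction_on (p := fun K => {a | a ∈ K ∧ rng a = x}.Finite) ?_ ?_ ?_ ?_
  · simp
  · exact fun s t hst ht => ht.subset fun a ha => ⟨hst ha.1, ha.2⟩
  · exact fun s t hs ht => (hs.union ht).subset fun a ha =>
      ha.1.elim (fun h => Or.inl ⟨h, ha.2⟩) fun h => Or.inr ⟨h, ha.2⟩
  · intro a _
    obtain ⟨B, -, hB, haB, -⟩ := exists_compact_openBisection isOpen_univ (mem_univ a)
    refine ⟨B, mem_nhdsWithin_of_mem_nhds (hB.isOpen.mem_nhds haB), Set.Subsingleton.finite ?_⟩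
    exact fun b hb c hc => hB.injOn_rng hb.1 hc.1 (hb.2.trans hc.2.symm)

theorem continuousOn_invFunOn_rng [Nonempty G] {B : Set G} (hB : IsOpenBisection B) :
    ContinuousOn (Function.invFunOn rng B) (rng '' B) := by
  rw [continuousOn_open_iff hB.isOpen_rng]
  intro U hU
  -- The preimage of `U` under the inverse of `r|_B` is `r(B ∩ U)`.
  convert isOpenMap_rng _ (hB.isOpen.inter hU) using 1
  ext x
  constructor
  · rintro ⟨hx, hxU⟩
    exact ⟨_, ⟨Function.invFunOn_mem hx, hxU⟩, Function.invFunOn_eq hx⟩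
  · rintro ⟨b, ⟨hb, hbU⟩, rfl⟩
    refine ⟨mem_image_of_mem _ hb, ?_⟩
    rwa [mem_preimage, hB.injOn_rng.leftInvOn_invFunOn hb]

/-- By the Hausdorff property the composable pairs are closed in `G × G`, so those in `K × L` form a
compact set, on which multiplication is continuous. -/
theorem isCompact_mul [T2Space G] {K L : Set G} (hK : IsCompact K) (hL : IsCompact L) :
    IsCompact {c | ∃ a ∈ K, ∃ b ∈ L, src a = rng b ∧ a * b = c} := by
  have h1 : IsClosed {p : G × G | src p.1 = rng p.2} :=
    isClosed_eq (continuous_src.comp continuous_fst) (continuous_rng.comp continuous_snd)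
  have h2 := ((hK.prod hL).inter_right h1).image_of_continuousOn
    ((IsTopologicalGroupoid.continuousOn_mul (G := G)).mono
      fun p hp => composable_iff.mpr hp.2)
  convert h2 using 1
  ext c
  constructor
  · rintro ⟨a, ha, b, hb, h, rfl⟩
    exact ⟨(a, b), ⟨⟨ha, hb⟩, h⟩, rfl⟩
  · rintro ⟨⟨a, b⟩, ⟨⟨ha, hb⟩, h⟩, rfl⟩
    exact ⟨a, ha, b, hb, h, rfl⟩

end Topology

end ArrowGroupoid

namespace DiscreteTwist

/-! ### The action of `Rˣ` on the twist, and local sections -/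

section Action

variable {R S G : Type*} [CommRing R]
    [TopologicalSpace S] [ArrowGroupoid S] [IsTopologicalGroupoid S]
    [TopologicalSpace G] [ArrowGroupoid G] [IsTopologicalGroupoid G]
    (W : DiscreteTwist R S G)

theorem q_i (x : unitSpace G) (t : Rˣ) : W.q (W.i (x, t)) = x := by
  have h : W.i (x, t) ∈ W.q ⁻¹' {(x : G)} := by
    rw [← W.exact x]
    exact ⟨t, rfl⟩
  exact h

theorem q_inv (a : S) : W.q a⁻¹ = (W.q a)⁻¹ := by
  have h1 := W.q_composable (inv_composable a)
  have h2 := W.q_mul (inv_composable a)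
  have h3 : W.q (src a) = src (W.q a) := eq_src_of_composable
    (W.q_unit_image ▸ mem_image_of_mem _ (src_mem a)) (W.q_composable (composable_src a))
  rw [← mul_inv_cancel_right' h1, ← h2]
  change W.q (src a) * _ = _
  rw [h3, ← rng_inv, rng_mul]

theorem q_src (a : S) : W.q (src a) = src (W.q a) := by
  rw [src, W.q_mul (inv_composable a), q_inv, src]

theorem q_rng (a : S) : W.q (rng a) = rng (W.q a) := by
  rw [rng, W.q_mul (composable_inv a), q_inv, rng]

theorem q_mul_of_eq {a b : S} (h : src a = rng b) : W.q (a * b) = W.q a * W.q b :=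
  W.q_mul (composable_iff.mpr h)

theorem q_injOn_unitSpace : InjOn W.q (unitSpace S) :=
  Set.injOn_iff_injective.mpr W.q_unit_embedding.injective

/-- Since `q` is injective on units, coincidence of ranges and sources, and with it composability,
can be tested in `G`. -/
theorem rng_eq_rng_iff {a b : S} : rng a = rng b ↔ rng (W.q a) = rng (W.q b) := by
  rw [← q_rng, ← q_rng]
  exact ⟨congrArg _, fun h => W.q_injOn_unitSpace (rng_mem a) (rng_mem b) h⟩

theorem src_eq_src_iff {a b : S} : src a = src b ↔ src (W.q a) = src (W.q b) := by
  rw [← q_src, ← q_src]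
  exact ⟨congrArg _, fun h => W.q_injOn_unitSpace (src_mem a) (src_mem b) h⟩

theorem src_eq_rng_iff {a b : S} : src a = rng b ↔ src (W.q a) = rng (W.q b) := by
  rw [← q_src, ← q_rng]
  exact ⟨congrArg _, fun h => W.q_injOn_unitSpace (src_mem a) (rng_mem b) h⟩

theorem i_one_mem (x : unitSpace G) : W.i (x, 1) ∈ unitSpace S :=
  W.i_unit_range ▸ Set.mem_range_self x

theorem i_one_rngU (a : S) : W.i (rngU (W.q a), 1) = rng a :=
  W.q_injOn_unitSpace (W.i_one_mem _) (rng_mem a) ((W.q_i _ _).trans (W.q_rng a).symm)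

theorem i_one_srcU (a : S) : W.i (srcU (W.q a), 1) = src a :=
  W.q_injOn_unitSpace (W.i_one_mem _) (src_mem a) ((W.q_i _ _).trans (W.q_src a).symm)

theorem src_i (x : unitSpace G) (t : Rˣ) : src (W.i (x, t)) = W.i (x, 1) :=
  W.q_injOn_unitSpace (src_mem _) (W.i_one_mem _)
    (by rw [q_src, q_i, q_i, src_eq_self x.2])

theorem rng_i (x : unitSpace G) (t : Rˣ) : rng (W.i (x, t)) = W.i (x, 1) :=
  W.q_injOn_unitSpace (rng_mem _) (W.i_one_mem _)
    (by rw [q_rng, q_i, q_i, rng_eq_self x.2])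

theorem src_i_rngU (a : S) (t : Rˣ) : src (W.i (rngU (W.q a), t)) = rng a := by
  rw [src_i, i_one_rngU]

theorem rng_i_srcU (a : S) (t : Rˣ) : rng (W.i (srcU (W.q a), t)) = src a := by
  rw [rng_i, i_one_srcU]

theorem q_act (t : Rˣ) (a : S) : W.q (W.act t a) = W.q a := by
  rw [act, W.q_mul_of_eq (W.src_i_rngU a t), q_i]
  exact rng_mul _

theorem rng_act (t : Rˣ) (a : S) : rng (W.act t a) = rng a := by
  rw [W.rng_eq_rng_iff, q_act]

theorem src_act (t : Rˣ) (a : S) : src (W.act t a) = src a := by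
  rw [W.src_eq_src_iff, q_act]

theorem act_one (a : S) : W.act 1 a = a := by
  rw [act, i_one_rngU, rng_mul]

theorem act_act (t u : Rˣ) (a : S) : W.act t (W.act u a) = W.act (t * u) a := by
  rw [act, q_act, act, ← mul_assoc_of_eq (by rw [src_i, rng_i]) (W.src_i_rngU a u), W.i_mul, act]

theorem act_mul {a b : S} (h : src a = rng b) (t : Rˣ) : W.act t a * b = W.act t (a * b) := by
  have e : rngU (W.q (a * b)) = rngU (W.q a) :=
    Subtype.ext (W.rng_eq_rng_iff.mp (rng_mul_eq h))
  rw [act, act, mul_assoc_of_eq (W.src_i_rngU a t) h, e]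

theorem mul_act {a b : S} (h : src a = rng b) (t : Rˣ) : a * W.act t b = W.act t (a * b) := by
  have e : rngU (W.q b) = srcU (W.q a) := Subtype.ext (W.src_eq_rng_iff.mp h).symm
  rw [← W.act_mul h, act, act, W.central a t,
    mul_assoc_of_eq (W.rng_i_srcU a t).symm (by rw [← e, W.src_i_rngU]), e]

theorem inv_act (t : Rˣ) (a : S) : (W.act t a)⁻¹ = W.act t⁻¹ a⁻¹ := by
  have h : src a = rng a⁻¹ := (rng_inv a).symm
  have h1 : W.act t a * W.act t⁻¹ a⁻¹ = rng a := by
    rw [W.mul_act (by rw [src_act, h]), W.act_mul h, act_act, inv_mul_cancel, act_one, rng]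
  have h2 : src (W.act t a) = rng (W.act t⁻¹ a⁻¹) := by rw [src_act, rng_act, h]
  rw [← inv_mul_cancel_left_of_eq h2, h1, ← W.rng_act t a, ← src_inv, mul_src]

theorem act_injective (a : S) : Function.Injective fun t : Rˣ => W.act t a := by
  intro t u h
  have h1 := mul_right_cancel_of_eq (W.src_i_rngU a t) (W.src_i_rngU a u) h
  exact (Prod.mk.inj (W.i_injective h1)).2

/-- The arrow `b a⁻¹` lies over a unit, so exactness writes it as `i(r(a), t)`. Together with
`act_injective`, the fibres of `q` are `Rˣ`-torsors. -/
theorem exists_act_eq {a b : S} (h : W.q a = W.q b) : ∃ t : Rˣ, b = W.act t a := by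
  have hr : rng a⁻¹ = rng b⁻¹ := by rw [W.rng_eq_rng_iff, q_inv, q_inv, h]
  have hs : src b = rng a⁻¹ := by rw [hr, rng_inv]
  have h1 : W.q (b * a⁻¹) = rng (W.q a) := by
    rw [W.q_mul_of_eq hs, q_inv, ← h, rng]
  have h2 : b * a⁻¹ ∈ W.q ⁻¹' {((rngU (W.q a) : unitSpace G) : G)} := h1
  rw [← W.exact] at h2
  obtain ⟨t, ht⟩ := h2
  refine ⟨t, ?_⟩
  change W.i (rngU (W.q a), t) = b * a⁻¹ at ht
  have h3 := mul_inv_cancel_right_of_eq hs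
  rw [inv_inv'] at h3
  rw [act, ht, h3]

theorem mem_unitSpace_of_rng_eq {a : S} (h : W.q a ∈ unitSpace G) : rng a = src a := by
  refine W.q_injOn_unitSpace (rng_mem a) (src_mem a) ?_
  rw [q_rng, q_src, rng_eq_self h, src_eq_self h]

/-- Every point of the twist lies on a continuous local section of `q`. -/
theorem exists_local_section (a : S) : ∃ (B : Set G) (P : G → S), IsOpen B ∧ W.q a ∈ B ∧
    ContinuousOn P B ∧ (∀ b ∈ B, W.q (P b) = b) ∧ P (W.q a) = a := by
  classical
  obtain ⟨B, hB, haB, P, hP, hqP, hemb, hran⟩ := W.locally_trivial (W.q a)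
  have ha : a ∈ W.q ⁻¹' B := haB
  rw [← hran] at ha
  obtain ⟨⟨b, t⟩, hb⟩ := ha
  have hb' : W.act t (P b) = a := by rw [act, hqP]; exact hb
  have hba : (b : G) = W.q a := by rw [← hb', q_act, hqP]
  -- The section `P` need not pass through `a`; rescaling it by the constant `t` makes it do so. The
  -- value `a` off `B` plays no role.
  refine ⟨B, fun x => if h : x ∈ B then W.act t (P ⟨x, h⟩) else a, hB.isOpen, haB, ?_, ?_, ?_⟩
  · rw [continuousOn_iff_continuous_domRestrict]
    have h1 := hemb.continuous.comp (continuous_id.prodMk (continuous_const (y := t)))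
    convert h1 using 1
    funext x
    simp only [domRestrict_apply, x.2, dif_pos, act, hqP]
    rfl
  · intro x hx
    simp only [hx, dif_pos, q_act, hqP]
  · have h1 : (⟨W.q a, haB⟩ : B) = b := Subtype.ext hba.symm
    refine (dif_pos haB).trans ?_
    rw [h1, hb']

theorem isOpenMap_q : IsOpenMap W.q := by
  intro U hU
  rw [isOpen_iff_mem_nhds]
  rintro _ ⟨a, ha, rfl⟩
  obtain ⟨B, P, hB, haB, hP, hqP, hPa⟩ := W.exists_local_section a
  have h1 := (hP.continuousAt (hB.mem_nhds haB)).preimage_mem_nhds (t := U)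
    (hU.mem_nhds (hPa.symm ▸ ha))
  filter_upwards [h1, hB.mem_nhds haB] with x hx hxB
  exact ⟨P x, hx, hqP x hxB⟩

end Action

end DiscreteTwist

namespace DiscreteTwist

/-! ### Convolution as a sum over a fibre of the range map -/

section Convolution

variable {R S G : Type*} [CommRing R]
    [TopologicalSpace S] [ArrowGroupoid S] [IsTopologicalGroupoid S]
    [TopologicalSpace G] [ArrowGroupoid G] [IsTopologicalGroupoid G]
    (W : DiscreteTwist R S G)

/-- `f(t · σ) = t⁻¹ f(σ)`. -/
def IsContravariant (f : S → R) : Prop :=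
  ∀ (t : Rˣ) (a : S), f (W.act t a) = ((t⁻¹ : Rˣ) : R) * f a

variable {W} {f g h : S → R}

theorem q_sec (α : G) : W.q (W.sec α) = α := Function.surjInv_eq W.q_surjective α

theorem rng_sec {α : G} {a : S} (h : rng α = rng (W.q a)) : rng (W.sec α) = rng a := by
  rw [W.rng_eq_rng_iff, q_sec, h]

theorem IsContravariant.eq_zero_iff (hf : W.IsContravariant f) {a b : S} (h : W.q a = W.q b) :
    f a = 0 ↔ f b = 0 := by
  obtain ⟨t, rfl⟩ := W.exists_act_eq h
  rw [hf, Units.mul_right_eq_zero]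

theorem IsContravariant.mem_suppG_iff (hf : W.IsContravariant f) {a : S} :
    W.q a ∈ W.suppG f ↔ f a ≠ 0 := by
  constructor
  · rintro ⟨b, hb, hba⟩
    exact fun h => hb ((hf.eq_zero_iff hba).mpr h)
  · exact fun h => mem_image_of_mem _ h

/-- Replacing `c` by `t · c` multiplies the two factors by `t⁻¹` and `t`. Hence a term of the
convolution does not depend on the chosen lift. -/
theorem IsContravariant.mul_eq (hf : W.IsContravariant f) (hg : W.IsContravariant g)
    {a c d : S} (hcd : W.q c = W.q d) (hc : rng c = rng a) :
    f c * g (c⁻¹ * a) = f d * g (d⁻¹ * a) := by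
  obtain ⟨t, rfl⟩ := W.exists_act_eq hcd
  rw [W.inv_act, W.act_mul (by rw [src_inv, hc]), hf, hg, inv_inv]
  calc f c * g (c⁻¹ * a) = ((t⁻¹ * t : Rˣ) : R) * (f c * g (c⁻¹ * a)) := by simp
    _ = _ := by push_cast; ring

/-- Terms outside the support of `f` vanish, so the support condition can be dropped. A free `x`
lets the sums for different `a` share one index type. -/
theorem conv_eq_finsum {x : G} {a : S} (hx : rng (W.q a) = x) :
    W.conv f g a = ∑ᶠ α : {α : G // rng α = x}, f (W.sec α) * g ((W.sec α)⁻¹ * a) := by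
  subst hx
  have h : W.conv f g a = ∑ᶠ α ∈ {α : G | rng α = rng (W.q a)},
      f (W.sec α) * g ((W.sec α)⁻¹ * a) := by
    refine finsum_mem_inter_support_eq' _ _ _ fun α hα => ?_
    refine ⟨fun h => h.1, fun h => ⟨h, W.sec α, ?_, q_sec α⟩⟩
    exact left_ne_zero_of_mul hα
  rw [h]
  exact (finsum_set_coe_eq_finsum_mem _).symm

/-- The main computational tool: when one factor lives on a bisection, the sum collapses to one
term, evaluated at any convenient lift `c`. -/
theorem conv_eq_single (hf : W.IsContravariant f) (hg : W.IsContravariant g) {a c : S}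
    (hc : rng c = rng a)
    (h : ∀ d, rng d = rng a → f d ≠ 0 → g (d⁻¹ * a) ≠ 0 → W.q d = W.q c) :
    W.conv f g a = f c * g (c⁻¹ * a) := by
  rw [conv_eq_finsum rfl, finsum_eq_single _ ⟨W.q c, W.rng_eq_rng_iff.mp hc⟩]
  · exact hf.mul_eq hg (q_sec _) (rng_sec (W.rng_eq_rng_iff.mp hc))
  · rintro ⟨α, hα⟩ hne
    by_contra h0
    refine hne (Subtype.ext ?_)
    have h1 := h (W.sec α) (rng_sec hα) (left_ne_zero_of_mul h0) (right_ne_zero_of_mul h0)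
    rwa [q_sec] at h1

theorem exists_of_conv_ne_zero {a : S} (h : W.conv f g a ≠ 0) :
    ∃ c, rng c = rng a ∧ f c ≠ 0 ∧ g (c⁻¹ * a) ≠ 0 := by
  by_contra! hc
  refine h ?_
  rw [conv_eq_finsum rfl]
  refine finsum_eq_zero_of_forall_eq_zero fun α => ?_
  by_cases h0 : f (W.sec α) = 0
  · rw [h0, zero_mul]
  · rw [hc _ (rng_sec α.2) h0, mul_zero]

theorem suppG_conv_subset :
    W.suppG (W.conv f g) ⊆ {c | ∃ a ∈ W.suppG f, ∃ b ∈ W.suppG g, src a = rng b ∧ a * b = c} := by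
  rintro _ ⟨a, ha, rfl⟩
  obtain ⟨c, hc, hf, hg⟩ := exists_of_conv_ne_zero ha
  have h : src c = rng (c⁻¹ * a) := (rng_inv_mul hc).symm
  refine ⟨_, mem_image_of_mem _ hf, _, mem_image_of_mem _ hg, W.src_eq_rng_iff.mp h, ?_⟩
  rw [← W.q_mul_of_eq h, mul_inv_cancel_left_of_eq hc]

theorem IsContravariant.conv (hg : W.IsContravariant g) : W.IsContravariant (W.conv f g) := by
  intro t a
  rw [conv_eq_finsum (W.q_act t a ▸ rfl : rng (W.q (W.act t a)) = rng (W.q a)),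
    conv_eq_finsum rfl]
  have h : ∀ α : {α : G // rng α = rng (W.q a)},
      f (W.sec α) * g ((W.sec α)⁻¹ * W.act t a) =
        ((t⁻¹ : Rˣ) : R) * (f (W.sec α) * g ((W.sec α)⁻¹ * a)) := fun α => by
    rw [W.mul_act (by rw [src_inv, rng_sec α.2]), hg]
    ring
  rw [finsum_congr h]
  by_cases hfin : (Function.support fun α : {α : G // rng α = rng (W.q a)} =>
      f (W.sec α) * g ((W.sec α)⁻¹ * a)).Finite
  · exact (mul_finsum' _ _ hfin).symm
  -- Without compactness the support may be infinite. Scaling by a unit does not change it, so both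
  -- sums then take the default value `0`.
  · rw [finsum_of_infinite_support hfin, mul_zero, finsum_of_infinite_support]
    convert hfin using 2
    ext α
    simp [Units.mul_right_eq_zero]

end Convolution

/-! ### The twisted Steinberg algebra is closed under an associative convolution -/

section Ample

variable {R S G : Type*} [CommRing R]
    [TopologicalSpace S] [ArrowGroupoid S] [IsTopologicalGroupoid S]
    [TopologicalSpace G] [ArrowGroupoid G] [IsAmple G]
    {W : DiscreteTwist R S G} {f g h : S → R}

theorem finite_fibre (hf : IsCompact (W.suppG f)) (x : G) :
    {α : {α : G // rng α = x} | f (W.sec α) ≠ 0}.Finite := by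
  refine Set.Finite.of_finite_image ?_ Subtype.val_injective.injOn
  refine (finite_rng_fibre hf x).subset ?_
  rintro _ ⟨α, hα, rfl⟩
  exact ⟨⟨W.sec α, hα, q_sec _⟩, α.2⟩

theorem conv_add_left {f' : S → R} (hf : IsCompact (W.suppG f)) (hf' : IsCompact (W.suppG f')) :
    W.conv (f + f') g = W.conv f g + W.conv f' g := by
  funext a
  rw [Pi.add_apply, conv_eq_finsum rfl, conv_eq_finsum rfl, conv_eq_finsum rfl,
    ← finsum_add_distrib]
  · exact finsum_congr fun α => by rw [Pi.add_apply, add_mul]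
  · exact (finite_fibre hf _).subset fun α hα => left_ne_zero_of_mul hα
  · exact (finite_fibre hf' _).subset fun α hα => left_ne_zero_of_mul hα

/-- Both sides are the double sum of `f(β) g(β⁻¹α) h(α⁻¹a)`. For fixed `β` the substitution `α = βδ`
turns the sum over `α` into the convolution of `g` and `h` at `β⁻¹a`. -/
theorem conv_assoc (hf : f ∈ W.steinbergAlgebra) (hg : g ∈ W.steinbergAlgebra)
    (hh : h ∈ W.steinbergAlgebra) : W.conv (W.conv f g) h = W.conv f (W.conv g h) := by
  funext a
  have hF := finite_fibre hf.2.2 (rng (W.q a))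
  have key : ∀ β : {β : G // rng β = rng (W.q a)},
      (Function.support fun α : {α : G // rng α = rng (W.q a)} =>
        f (W.sec β) * g ((W.sec β)⁻¹ * W.sec α) * h ((W.sec α)⁻¹ * a)).Finite ∧
      ∑ᶠ α : {α : G // rng α = rng (W.q a)},
        f (W.sec β) * g ((W.sec β)⁻¹ * W.sec α) * h ((W.sec α)⁻¹ * a) =
      f (W.sec β) * W.conv g h ((W.sec β)⁻¹ * a) := by
    rintro ⟨β, hβ⟩
    have hr : rng (W.sec β) = rng a := rng_sec hβ
    have hx : rng (W.q ((W.sec β)⁻¹ * a)) = src β := by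
      rw [← W.q_rng, rng_inv_mul hr, W.q_src, q_sec]
    have hfin : (Function.support fun δ : {δ : G // rng δ = src β} =>
        g (W.sec δ) * h ((W.sec δ)⁻¹ * ((W.sec β)⁻¹ * a))).Finite :=
      (finite_fibre hg.2.2 (src β)).subset fun δ hδ => left_ne_zero_of_mul hδ
    let e : {δ : G // rng δ = src β} ≃ {α : G // rng α = rng (W.q a)} :=
      (mulLeftEquiv β).trans (Equiv.subtypeEquivRight fun α => by rw [hβ])
    have hterm : ∀ δ : {δ : G // rng δ = src β},
        f (W.sec β) * g ((W.sec β)⁻¹ * W.sec (e δ)) * h ((W.sec (e δ))⁻¹ * a) =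
        f (W.sec β) * (g (W.sec δ) * h ((W.sec δ)⁻¹ * ((W.sec β)⁻¹ * a))) := by
      intro δ
      have he : ((e δ : {α : G // rng α = rng (W.q a)}) : G) = β * δ := rfl
      have hre : rng (W.sec (e δ)) = rng a := rng_sec (e δ).2
      have hbe : rng (W.sec β) = rng (W.sec (e δ)) := hr.trans hre.symm
      have hb' : src (W.sec β)⁻¹ = rng (W.sec (e δ)) := by rw [src_inv, hbe]
      have hq : W.q ((W.sec β)⁻¹ * W.sec (e δ)) = W.q (W.sec δ) := by
        rw [W.q_mul_of_eq hb', W.q_inv, q_sec, q_sec, q_sec, he,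
          inv_mul_cancel_left_of_eq δ.2.symm]
      -- The section is not multiplicative: `(sec β)⁻¹ sec(βδ)` and `sec δ` are different lifts of
      -- `δ`, and `mul_eq` absorbs the difference.
      have hrd : rng ((W.sec β)⁻¹ * W.sec (e δ)) = rng ((W.sec β)⁻¹ * a) := by
        rw [rng_inv_mul hbe, rng_inv_mul hr]
      have h1 := IsContravariant.mul_eq (W := W) hg.2.1 hh.2.1 hq hrd
      rw [← h1, mul_assoc]
      congr 3
      rw [mul_inv_rev_of_eq hb', inv_inv', mul_assoc_of_eq (by rw [src_inv, hbe])
        (by rw [rng_inv_mul hr]), mul_inv_cancel_left_of_eq hr]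
    constructor
    · refine (hfin.image e).subset fun α hα => ⟨e.symm α, ?_, e.apply_symm_apply α⟩
      have h1 := hterm (e.symm α)
      rw [e.apply_symm_apply] at h1
      rw [Function.mem_support, h1] at hα
      exact right_ne_zero_of_mul hα
    · rw [← finsum_comp_equiv e, finsum_congr hterm, conv_eq_finsum hx, ← mul_finsum' _ _ hfin]
  -- One finite index set for `β`, independent of `α`, permits the exchange of the two sums.
  have hsum : ∀ F : {β : G // rng β = rng (W.q a)} → R, (∀ β : {β : G // rng β = rng (W.q a)}, f (W.sec β) = 0 → F β = 0) →
      ∑ᶠ β, F β = ∑ β ∈ hF.toFinset, F β := fun F hFz =>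
    finsum_eq_sum_of_support_subset _ fun β hβ => by
      rw [Finite.coe_toFinset]
      exact fun h0 => hβ (hFz β h0)
  rw [conv_eq_finsum rfl, conv_eq_finsum (f := f) rfl,
    hsum (fun β => f (W.sec β) * W.conv g h ((W.sec β)⁻¹ * a)) fun β h0 => by rw [h0, zero_mul]]
  have h1 : ∀ α : {α : G // rng α = rng (W.q a)},
      W.conv f g (W.sec α) * h ((W.sec α)⁻¹ * a) =
      ∑ β ∈ hF.toFinset, f (W.sec β) * g ((W.sec β)⁻¹ * W.sec α) * h ((W.sec α)⁻¹ * a) := by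
    intro α
    rw [conv_eq_finsum (x := rng (W.q a)) (by rw [q_sec, α.2]),
      hsum _ fun β h0 => by rw [h0, zero_mul], Finset.sum_mul]
  rw [finsum_congr h1, finsum_sum_comm _ _ fun β _ => (key β).1]
  exact Finset.sum_congr rfl fun β _ => (key β).2

theorem isOpen_suppG (hf : IsLocallyConstant f) : IsOpen (W.suppG f) :=
  W.isOpenMap_q _ (hf {0}ᶜ)

/-- By contravariance, vanishing depends only on the image under `q`. So the complement is the
`q`-image of the open zero set, and `q` is open. -/
theorem isClosed_suppG (hf : IsLocallyConstant f) (hf' : W.IsContravariant f) :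
    IsClosed (W.suppG f) := by
  have h : (W.suppG f)ᶜ = W.q '' (f ⁻¹' {0}) := by
    ext α
    obtain ⟨a, rfl⟩ := W.q_surjective α
    rw [mem_compl_iff, hf'.mem_suppG_iff, not_not]
    constructor
    · exact fun h => ⟨a, h, rfl⟩
    · rintro ⟨b, hb, hba⟩
      exact (hf'.eq_zero_iff hba).mp hb
  rw [← isOpen_compl_iff, h]
  exact W.isOpenMap_q _ (hf {0})

/-- Near a point over `r(B)` the convolution is the single term `f(L b) g((L b)⁻¹ b)`, where `L`
lifts the inverse of `r|_B` continuously to the twist. -/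
theorem isLocallyConstant_conv_of_bisection [T2Space G] {B : Set G} (hB : IsOpenBisection B)
    (hBc : IsCompact B) (hf : IsLocallyConstant f) (hf' : W.IsContravariant f)
    (hfB : W.suppG f ⊆ B) (hg : IsLocallyConstant g) (hg' : W.IsContravariant g) :
    IsLocallyConstant (W.conv f g) := by
  rw [IsLocallyConstant.iff_eventually_eq]
  intro a
  have hrq : Continuous fun a : S => rng (W.q a) := continuous_rng.comp W.continuous_q
  by_cases h0 : rng (W.q a) ∈ rng '' B
  · obtain ⟨β, hβ, hβa⟩ := h0
    obtain ⟨D, P, hD, hβD, hP, hqP, -⟩ := W.exists_local_section (W.sec β)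
    rw [q_sec] at hβD
    have hDB : IsOpenBisection (D ∩ B) := isOpenBisection_of_injOn (hD.inter hB.isOpen)
      (hB.injOn_rng.mono inter_subset_right) (hB.injOn_src.mono inter_subset_right)
    have : Nonempty G := ⟨β⟩
    set ψ := Function.invFunOn rng (D ∩ B)
    set O := (fun a : S => rng (W.q a)) ⁻¹' (rng '' (D ∩ B))
    have hO : IsOpen O := hDB.isOpen_rng.preimage hrq
    have haO : a ∈ O := ⟨β, ⟨hβD, hβ⟩, hβa⟩
    have hψ : ∀ b ∈ O, ψ (rng (W.q b)) ∈ D ∩ B := fun b hb => Function.invFunOn_mem hb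
    set L : S → S := fun b => P (ψ (rng (W.q b)))
    have hL : ContinuousOn L O := hP.comp
      ((continuousOn_invFunOn_rng hDB).comp hrq.continuousOn fun b hb => hb)
      fun b hb => (hψ b hb).1
    have hqL : ∀ b ∈ O, W.q (L b) = ψ (rng (W.q b)) := fun b hb => hqP _ (hψ b hb).1
    have hrL : ∀ b ∈ O, rng (L b) = rng b := fun b hb => by
      rw [W.rng_eq_rng_iff, hqL b hb]
      exact Function.invFunOn_eq hb
    have hM : ContinuousOn (fun b => (L b)⁻¹ * b) O :=
      (IsTopologicalGroupoid.continuousOn_mul (G := S)).comp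
        ((IsTopologicalGroupoid.continuous_inv'.comp_continuousOn hL).prodMk continuousOn_id)
        fun b hb => composable_iff.mpr ((src_inv _).trans (hrL b hb))
    have hval : ∀ b ∈ O, W.conv f g b = f (L b) * g ((L b)⁻¹ * b) := fun b hb =>
      conv_eq_single hf' hg' (hrL b hb) fun d hd hfd _ =>
        hB.injOn_rng (hfB (mem_image_of_mem _ hfd)) (hqL b hb ▸ (hψ b hb).2)
          (W.rng_eq_rng_iff.mp (hd.trans (hrL b hb).symm))
    have h1 := (hL.continuousAt (hO.mem_nhds haO)).preimage_mem_nhds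
      ((hf.isOpen_fiber (f (L a))).mem_nhds rfl)
    have h2 := (hM.continuousAt (hO.mem_nhds haO)).preimage_mem_nhds
      ((hg.isOpen_fiber (g ((L a)⁻¹ * a))).mem_nhds rfl)
    filter_upwards [h1, h2, hO.mem_nhds haO] with b hb1 hb2 hbO
    rw [hval b hbO, hval a haO]
    exact congrArg₂ _ hb1 hb2
  -- Away from `r(B)` the convolution vanishes, and `r(B)` is closed, being compact in a Hausdorff
  -- space.
  · have hz : ∀ b, rng (W.q b) ∉ rng '' B → W.conv f g b = 0 := fun b hb => by
      by_contra h
      obtain ⟨c, hc, hfc, -⟩ := exists_of_conv_ne_zero h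
      exact hb ⟨W.q c, hfB (mem_image_of_mem _ hfc), W.rng_eq_rng_iff.mp hc⟩
    have hcl : IsClosed (rng '' B) := (hBc.image continuous_rng).isClosed
    filter_upwards [(hcl.isOpen_compl.preimage hrq).mem_nhds h0] with b hb
    rw [hz b hb, hz a h0]

theorem indicator_mem {B : Set G} (hB : IsClopen B) (hf : f ∈ W.steinbergAlgebra) :
    (W.q ⁻¹' B).indicator f ∈ W.steinbergAlgebra := by
  have hl : IsLocallyConstant ((W.q ⁻¹' B).indicator f) := by
    rw [IsLocallyConstant.iff_eventually_eq]
    intro a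
    have h1 := (IsLocallyConstant.iff_eventually_eq f).mp hf.1 a
    by_cases ha : a ∈ W.q ⁻¹' B
    · filter_upwards [h1, (hB.isOpen.preimage W.continuous_q).mem_nhds ha] with b hb hbB
      rw [indicator_of_mem ha, indicator_of_mem hbB, hb]
    · filter_upwards [(hB.compl.isOpen.preimage W.continuous_q).mem_nhds ha] with b hbB
      rw [indicator_of_notMem ha, indicator_of_notMem (s := W.q ⁻¹' B) hbB]
  have hc : W.IsContravariant ((W.q ⁻¹' B).indicator f) := by
    intro t a
    have h : W.act t a ∈ W.q ⁻¹' B ↔ a ∈ W.q ⁻¹' B := by rw [mem_preimage, W.q_act, mem_preimage]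
    by_cases ha : a ∈ W.q ⁻¹' B
    · rw [indicator_of_mem ha, indicator_of_mem (h.mpr ha), hf.2.1]
    · rw [indicator_of_notMem ha, indicator_of_notMem (h.not.mpr ha), mul_zero]
  refine ⟨hl, hc, hf.2.2.of_isClosed_subset (isClosed_suppG hl hc) (image_mono ?_)⟩
  rw [support_indicator]
  exact inter_subset_right

theorem suppG_indicator {B : Set G} : W.suppG ((W.q ⁻¹' B).indicator f) = B ∩ W.suppG f := by
  rw [suppG, support_indicator, inter_comm, image_inter_preimage, inter_comm]
  rfl

/-- Induction on the number of compact open bisections covering the support of `f`. Each is clopen,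
so cutting `f` along it stays in the algebra. -/
theorem isLocallyConstant_conv [T2Space G] (hf : f ∈ W.steinbergAlgebra)
    (hg : g ∈ W.steinbergAlgebra) : IsLocallyConstant (W.conv f g) := by
  classical
  choose B hBc hB hmem _ using fun a : G => exists_compact_openBisection isOpen_univ (mem_univ a)
  obtain ⟨t, -, ht⟩ := hf.2.2.elim_nhds_subcover B fun a _ => (hB a).isOpen.mem_nhds (hmem a)
  induction t using Finset.induction_on generalizing f with
  | empty =>
    have hz : W.conv f g = fun _ => 0 := by
      funext a
      by_contra h
      obtain ⟨c, -, hfc, -⟩ := exists_of_conv_ne_zero h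
      simpa using ht (mem_image_of_mem _ hfc)
    rw [hz]
    exact IsLocallyConstant.const 0
  | insert b t _ ih =>
    have hcl : IsClopen (B b) := ⟨(hBc b).isClosed, (hB b).isOpen⟩
    have h1 := indicator_mem hcl hf
    have h2 := indicator_mem hcl.compl hf
    have e : f = (W.q ⁻¹' B b).indicator f + (W.q ⁻¹' (B b)ᶜ).indicator f := by
      rw [preimage_compl, indicator_self_add_compl]
    rw [e, conv_add_left h1.2.2 h2.2.2]
    refine (isLocallyConstant_conv_of_bisection (hB b) (hBc b) h1.1 h1.2.1 ?_ hg.1 hg.2.1).add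
      (ih h2 ?_)
    · rw [suppG_indicator]
      exact inter_subset_left
    · rw [suppG_indicator]
      rintro x ⟨hx1, hx2⟩
      have h3 := ht hx2
      rw [Finset.set_biUnion_insert] at h3
      exact h3.resolve_left hx1

theorem conv_mem [T2Space G] (hf : f ∈ W.steinbergAlgebra) (hg : g ∈ W.steinbergAlgebra) :
    W.conv f g ∈ W.steinbergAlgebra := by
  have h1 := isLocallyConstant_conv hf hg
  have h2 : W.IsContravariant (W.conv f g) := IsContravariant.conv hg.2.1
  exact ⟨h1, h2, (isCompact_mul hf.2.2 hg.2.2).of_isClosed_subset (isClosed_suppG h1 h2)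
    suppG_conv_subset⟩

end Ample

end DiscreteTwist

/-! ### Products of normalisers in a semigroup -/

/-- `n` normalises the set `C`, with quasi-inverse `m`. -/
structure IsNormaliserPair {A : Type*} [Semigroup A] (C : Set A) (n m : A) : Prop where
  mul_mul_right : m * n * m = m
  mul_mul_left : n * m * n = n
  conj_right : ∀ f ∈ C, m * f * n ∈ C
  conj_left : ∀ f ∈ C, n * f * m ∈ C
  -- The last two conditions are not part of the definition of a normaliser; local units supply
  -- them, and products of normalisers need them.
  mul_mem_right : m * n ∈ C
  mul_mem_left : n * m ∈ C

namespace IsNormaliserPair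

variable {A : Type*} [Semigroup A] {C : Set A} {n m b d : A}

theorem symm (h : IsNormaliserPair C n m) : IsNormaliserPair C m n :=
  ⟨h.mul_mul_left, h.mul_mul_right, h.conj_left, h.conj_right, h.mul_mem_left, h.mul_mem_right⟩

/-- The idempotents `bd` and `mn` both lie in the commutative set `C`; interchanging them lets `n m
n` and `b d b` collapse. -/
theorem mul_mul_mul_eq (hC : ∀ x ∈ C, ∀ y ∈ C, x * y = y * x) (h : IsNormaliserPair C n m)
    (h' : IsNormaliserPair C b d) : n * b * (d * m) * (n * b) = n * b := by
  calc n * b * (d * m) * (n * b) = n * (b * d * (m * n)) * b := by simp only [mul_assoc]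
    _ = n * (m * n * (b * d)) * b := by rw [hC _ h'.mul_mem_left _ h.mul_mem_right]
    _ = n * m * n * (b * d * b) := by simp only [mul_assoc]
    _ = n * b := by rw [h.mul_mul_left, h'.mul_mul_left]

theorem conj_mul (h : IsNormaliserPair C n m) (h' : IsNormaliserPair C b d) {f : A} (hf : f ∈ C) :
    n * b * f * (d * m) ∈ C := by
  have h1 := h.conj_left _ (h'.conj_left f hf)
  simpa only [mul_assoc] using h1

theorem mul_mem_mul (h : IsNormaliserPair C n m) (h' : IsNormaliserPair C b d) :
    n * b * (d * m) ∈ C := by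
  have h1 := h.conj_left _ h'.mul_mem_left
  simpa only [mul_assoc] using h1

theorem mul (hC : ∀ x ∈ C, ∀ y ∈ C, x * y = y * x) (h : IsNormaliserPair C n m)
    (h' : IsNormaliserPair C b d) : IsNormaliserPair C (n * b) (d * m) where
  mul_mul_right := mul_mul_mul_eq hC h'.symm h.symm
  mul_mul_left := mul_mul_mul_eq hC h h'
  conj_right _ := conj_mul h'.symm h.symm
  conj_left _ := conj_mul h h'
  mul_mem_right := mul_mem_mul h'.symm h.symm
  mul_mem_left := mul_mem_mul h h'

end IsNormaliserPair

namespace DiscreteTwist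

/-! ### Convolution with diagonal elements -/

section Diagonal

variable {R S G : Type*} [CommRing R]
    [TopologicalSpace S] [ArrowGroupoid S] [IsTopologicalGroupoid S]
    [TopologicalSpace G] [ArrowGroupoid G] [IsTopologicalGroupoid G]
    {W : DiscreteTwist R S G} {d f : S → R}

theorem conv_diagonal_left (hd : W.IsContravariant d) (hd' : W.suppG d ⊆ unitSpace G)
    (hf : W.IsContravariant f) (a : S) : W.conv d f a = d (rng a) * f a := by
  rw [conv_eq_single hd hf (rng_rng a), inv_unit (rng_mem a), rng_mul]
  intro c hc hdc _
  rw [W.q_rng, ← W.rng_eq_rng_iff.mp hc, rng_eq_self (hd' (mem_image_of_mem _ hdc))]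

theorem conv_diagonal_right (hd : W.IsContravariant d) (hd' : W.suppG d ⊆ unitSpace G)
    (hf : W.IsContravariant f) (a : S) : W.conv f d a = f a * d (src a) := by
  rw [conv_eq_single hf hd (rfl : rng a = rng a), src]
  intro c hc _ hdc
  have h1 := hd' (mem_image_of_mem _ hdc)
  have h2 : src c = rng (c⁻¹ * a) := (rng_inv_mul hc).symm
  have h3 := W.q_mul_of_eq h2
  rw [mul_inv_cancel_left_of_eq hc, ← rng_eq_self h1, ← W.src_eq_rng_iff.mp h2, mul_src] at h3
  exact h3.symm

theorem conv_diagonal_comm (hd : d ∈ W.diagonal) (hf : f ∈ W.diagonal) :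
    W.conv d f = W.conv f d := by
  funext a
  rw [conv_diagonal_left hd.1.2.1 hd.2 hf.1.2.1, conv_diagonal_right hd.1.2.1 hd.2 hf.1.2.1,
    mul_comm]
  by_cases h : f a = 0
  · rw [h, zero_mul, zero_mul]
  · rw [W.mem_unitSpace_of_rng_eq (hf.2 (mem_image_of_mem _ h))]

theorem suppG_conv_diagonal_subset (hd : d ∈ W.diagonal) (hf : W.IsContravariant f) :
    W.suppG (W.conv f d) ⊆ W.suppG f := by
  rintro _ ⟨a, ha, rfl⟩
  refine mem_image_of_mem _ fun h => ha ?_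
  rw [conv_diagonal_right hd.1.2.1 hd.2 hf, h, zero_mul]

end Diagonal

/-! ### Charts, their bump functions, and normalisers -/

section Ample

variable {R S G : Type*} [CommRing R]
    [TopologicalSpace S] [ArrowGroupoid S] [IsTopologicalGroupoid S]
    [TopologicalSpace G] [ArrowGroupoid G] [IsAmple G]

/-- A compact open bisection `B` with a locally constant equivariant coordinate `t : q⁻¹(B) → Rˣ`. -/
structure IsChart (W : DiscreteTwist R S G) (B : Set G) (t : S → Rˣ) : Prop where
  isCompact : IsCompact B
  isOpenBisection : IsOpenBisection B
  eventually_eq : ∀ a, W.q a ∈ B → ∀ᶠ b in 𝓝 a, t b = t a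
  map_act : ∀ (u : Rˣ) (a : S), W.q a ∈ B → t (W.act u a) = u * t a

/-- The function `t⁻¹`, supported on `q⁻¹(B)`. -/
noncomputable def bump (W : DiscreteTwist R S G) (B : Set G) (t : S → Rˣ) : S → R :=
  (W.q ⁻¹' B).indicator fun a => (((t a)⁻¹ : Rˣ) : R)

variable {W : DiscreteTwist R S G} {B : Set G} {t : S → Rˣ} {f g n : S → R}

theorem bump_apply {a : S} (h : W.q a ∈ B) : W.bump B t a = (((t a)⁻¹ : Rˣ) : R) :=
  indicator_of_mem (s := W.q ⁻¹' B) h _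

theorem q_mem_of_bump_ne_zero {a : S} (h : W.bump B t a ≠ 0) : W.q a ∈ B := by
  by_contra h'
  exact h (indicator_of_notMem (s := W.q ⁻¹' B) h' _)

theorem suppG_bump_subset : W.suppG (W.bump B t) ⊆ B := by
  rintro _ ⟨a, ha, rfl⟩
  exact q_mem_of_bump_ne_zero ha

/-- The coordinate `t(a)` is the position of `a` relative to a local section: `a = t(a) · P(q(a))`.
-/
theorem exists_chart {U : Set G} (hU : IsOpen U) {α : G} (hα : α ∈ U) :
    ∃ (B : Set G) (t : S → Rˣ), W.IsChart B t ∧ α ∈ B ∧ B ⊆ U := by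
  classical
  obtain ⟨D, hD, hαD, P, hP, hqP, hemb, hran⟩ := W.locally_trivial α
  obtain ⟨B, hBc, hB, hαB, hBU⟩ := exists_compact_openBisection (hU.inter hD.isOpen) ⟨hα, hαD⟩
  have hex : ∀ a : S, ∃ u : Rˣ, ∀ h : W.q a ∈ D, a = W.act u (P ⟨W.q a, h⟩) := fun a => by
    by_cases h : W.q a ∈ D
    · obtain ⟨u, hu⟩ := W.exists_act_eq (hqP ⟨W.q a, h⟩)
      exact ⟨u, fun _ => hu⟩
    · exact ⟨1, fun h' => absurd h' h⟩
  choose t ht using hex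
  have htP : ∀ (b : D) (u : Rˣ), t (W.act u (P b)) = u := fun b u => by
    have hq : W.q (W.act u (P b)) = b := by rw [W.q_act, hqP]
    have hm : W.q (W.act u (P b)) ∈ D := hq ▸ b.2
    have h1 := ht _ hm
    have h2 : (⟨W.q (W.act u (P b)), hm⟩ : D) = b := Subtype.ext hq
    rw [h2] at h1
    exact (W.act_injective _ h1).symm
  refine ⟨B, t, ⟨hBc, hB, fun a ha => ?_, fun u a ha => ?_⟩, hαB, fun x hx => (hBU hx).1⟩
  · have hdisc : DiscreteTopology Rˣ := ⟨rfl⟩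
    have haD : W.q a ∈ D := (hBU ha).2
    have ho : IsOpenEmbedding (fun p : D × Rˣ => W.i (rngU (p.1 : G), p.2) * P p.1) :=
      ⟨hemb, by rw [hran]; exact hD.isOpen.preimage W.continuous_q⟩
    -- As `Rˣ` is discrete, the trivialisation maps the slice `D × {t(a)}` onto an open set, on
    -- which `t` is constant.
    have h1 := ho.isOpenMap _ ((isOpen_discrete {t a}).preimage (continuous_snd (X := D)))
    have hact : ∀ (b : D) (u : Rˣ), W.i (rngU (b : G), u) * P b = W.act u (P b) := fun b u => by
      rw [act, hqP]
    have h2 : a ∈ (fun p : D × Rˣ => W.i (rngU (p.1 : G), p.2) * P p.1) ''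
        (Prod.snd ⁻¹' {t a}) :=
      ⟨(⟨W.q a, haD⟩, t a), rfl, (hact _ _).trans (ht a haD).symm⟩
    filter_upwards [h1.mem_nhds h2] with b hb
    obtain ⟨⟨c, u⟩, hu, rfl⟩ := hb
    exact (congrArg t (hact c u)).trans ((htP c u).trans hu)
  · have haD : W.q a ∈ D := (hBU ha).2
    conv_lhs => rw [ht a haD, W.act_act, htP]

/-- Over units there is a canonical section, formed by the units of the twist, so the coordinate is
defined by `a = t(a) · r(a)`. -/
theorem exists_unit_chart {K : Set G} (hK : IsCompact K) (hKo : IsOpen K)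
    (hKu : K ⊆ unitSpace G) :
    ∃ t : S → Rˣ, W.IsChart K t ∧ ∀ x ∈ unitSpace S, t x = 1 := by
  have hex : ∀ a : S, ∃ u : Rˣ, W.q a ∈ unitSpace G → a = W.act u (rng a) := fun a => by
    by_cases h : W.q a ∈ unitSpace G
    · have h1 : W.q (rng a) = W.q a := by rw [W.q_rng, rng_eq_self h]
      obtain ⟨u, hu⟩ := W.exists_act_eq h1
      exact ⟨u, fun _ => hu⟩
    · exact ⟨1, fun h' => absurd h' h⟩
  choose t ht using hex
  have hqu : ∀ {x : S}, x ∈ unitSpace S → W.q x ∈ unitSpace G := fun hx =>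
    W.q_unit_image ▸ mem_image_of_mem _ hx
  have htr : ∀ {x : S} (u : Rˣ), x ∈ unitSpace S → t (W.act u x) = u := fun {x} u hx => by
    have h1 := ht (W.act u x) (by rw [W.q_act]; exact hqu hx)
    rw [W.rng_act, rng_eq_self hx] at h1
    exact (W.act_injective _ h1).symm
  refine ⟨t, ⟨hK, isOpenBisection_of_injOn hKo ?_ ?_, fun a ha => ?_, fun u a ha => ?_⟩, ?_⟩
  · intro x hx y hy h
    rwa [rng_eq_self (hKu hx), rng_eq_self (hKu hy)] at h
  · intro x hx y hy h
    rwa [src_eq_self (hKu hx), src_eq_self (hKu hy)] at h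
  · obtain ⟨B, τ, hτ, haB, -⟩ := exists_chart (W := W) isOpen_univ (mem_univ (W.q a))
    have hqr : ∀ b : S, W.q b ∈ K → W.q (rng b) = W.q b := fun b hb => by
      rw [W.q_rng, rng_eq_self (hKu hb)]
    -- Local constancy is inherited from an arbitrary chart `τ`, which need not equal `1` on units;
    -- dividing by its value at `r(b)` corrects this.
    have hval : ∀ b : S, W.q b ∈ K → W.q b ∈ B → t b = τ b * (τ (rng b))⁻¹ := fun b hbK hbB => by
      have h1 := hτ.map_act (t b) (rng b) ((hqr b hbK).symm ▸ hbB)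
      rw [← ht b (hKu hbK)] at h1
      rw [h1, mul_inv_cancel_right]
    have h2 := (continuous_rng (G := S)).continuousAt.eventually
      (hτ.eventually_eq (rng a) ((hqr a ha).symm ▸ haB))
    filter_upwards [h2, hτ.eventually_eq a haB, (hKo.preimage W.continuous_q).mem_nhds ha,
      (hτ.isOpenBisection.isOpen.preimage W.continuous_q).mem_nhds haB] with b hb1 hb2 hb3 hb4
    rw [hval b hb3 hb4, hval a ha haB, hb1, hb2]
  · conv_lhs => rw [ht a (hKu ha), W.act_act, htr _ (rng_mem a)]
  · intro x hx
    have h1 := htr 1 hx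
    rwa [W.act_one] at h1

namespace IsChart

theorem inv (h : W.IsChart B t) :
    W.IsChart ((fun α => α⁻¹) ⁻¹' B) fun a => (t a⁻¹)⁻¹ where
  isCompact := by
    have h1 := h.isCompact.image (IsTopologicalGroupoid.continuous_inv' (G := G))
    convert h1 using 1
    ext α
    constructor
    · exact fun hα => ⟨α⁻¹, hα, inv_inv' α⟩
    · rintro ⟨β, hβ, rfl⟩
      rwa [mem_preimage, inv_inv']
  isOpenBisection := by
    have hinj : ∀ {α β : G}, α⁻¹ = β⁻¹ → α = β := fun {α β} e => by
      rw [← inv_inv' α, e, inv_inv']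
    refine isOpenBisection_of_injOn
      (h.isOpenBisection.isOpen.preimage IsTopologicalGroupoid.continuous_inv') ?_ ?_
    · intro α hα β hβ e
      exact hinj (h.isOpenBisection.injOn_src hα hβ (by rw [src_inv, src_inv, e]))
    · intro α hα β hβ e
      exact hinj (h.isOpenBisection.injOn_rng hα hβ (by rw [rng_inv, rng_inv, e]))
  eventually_eq a ha := by
    have h1 : W.q a⁻¹ ∈ B := by rw [W.q_inv]; exact ha
    filter_upwards [(IsTopologicalGroupoid.continuous_inv' (G := S)).continuousAt.eventually
      (h.eventually_eq a⁻¹ h1)] with b hb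
    rw [hb]
  map_act u a ha := by
    have h1 : W.q a⁻¹ ∈ B := by rw [W.q_inv]; exact ha
    rw [W.inv_act, h.map_act _ _ h1, mul_inv, inv_inv]

theorem isContravariant (h : W.IsChart B t) : W.IsContravariant (W.bump B t) := by
  intro u a
  by_cases ha : W.q a ∈ B
  · rw [bump_apply ha, bump_apply ((W.q_act u a).symm ▸ ha), h.map_act u a ha, mul_inv,
      Units.val_mul]
  · have h1 : W.bump B t a = 0 := by_contra fun h' => ha (q_mem_of_bump_ne_zero h')
    have h2 : W.bump B t (W.act u a) = 0 := by_contra fun h' =>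
      ha (W.q_act u a ▸ q_mem_of_bump_ne_zero h')
    rw [h1, h2, mul_zero]

theorem bump_mem [T2Space G] (h : W.IsChart B t) : W.bump B t ∈ W.steinbergAlgebra := by
  have hl : IsLocallyConstant (W.bump B t) := by
    rw [IsLocallyConstant.iff_eventually_eq]
    intro a
    by_cases ha : W.q a ∈ B
    · filter_upwards [h.eventually_eq a ha,
        (h.isOpenBisection.isOpen.preimage W.continuous_q).mem_nhds ha] with b hb hbB
      rw [bump_apply ha, bump_apply (B := B) (a := b) hbB, hb]
    · filter_upwards [(h.isCompact.isClosed.isOpen_compl.preimage W.continuous_q).mem_nhds ha]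
        with b hbB
      exact (indicator_of_notMem (s := W.q ⁻¹' B) hbB _).trans
        (indicator_of_notMem (s := W.q ⁻¹' B) ha _).symm
  exact ⟨hl, h.isContravariant,
    h.isCompact.of_isClosed_subset (isClosed_suppG hl h.isContravariant) suppG_bump_subset⟩

/-- As `s` is injective on `B`, `αβ` has only one factorisation with second factor in `B`. The
convolution there is `n(a)` times a unit, so nothing cancels. -/
theorem mul_mem_suppG_right (h : W.IsChart B t) (hn : W.IsContravariant n) {α β : G}
    (hα : α ∈ W.suppG n) (hβ : β ∈ B) (e : src α = rng β) :
    α * β ∈ W.suppG (W.conv n (W.bump B t)) := by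
  obtain ⟨a, ha, rfl⟩ := hα
  have e' : src a = rng (W.sec β) := by rw [W.src_eq_rng_iff, q_sec, e]
  have hqm : W.q (a * W.sec β) = W.q a * β := by rw [W.q_mul_of_eq e', q_sec]
  refine ⟨a * W.sec β, ?_, hqm⟩
  rw [Function.mem_support, conv_eq_single hn h.isContravariant (rng_mul_eq e').symm,
    inv_mul_cancel_left_of_eq e', bump_apply ((q_sec (W := W) β).symm ▸ hβ)]
  · exact fun h0 => ha ((Units.mul_left_eq_zero _).mp h0)
  · intro c hc _ hb
    have hc' : src c⁻¹ = rng (a * W.sec β) := by rw [src_inv, hc]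
    have h1 : W.q (c⁻¹ * (a * W.sec β)) = β := by
      refine h.isOpenBisection.injOn_src (q_mem_of_bump_ne_zero hb) hβ ?_
      rw [← W.q_src, src_mul_eq hc', src_mul_eq e', W.q_src, q_sec]
    have h2 : src c = rng (c⁻¹ * (a * W.sec β)) := (rng_inv_mul hc).symm
    have h3 := W.q_mul_of_eq h2
    have h4 := W.src_eq_rng_iff.mp h2
    rw [mul_inv_cancel_left_of_eq hc, hqm, h1] at h3
    rw [h1] at h4
    exact (mul_right_cancel_of_eq e h4 h3).symm

theorem mul_mem_suppG_left (h : W.IsChart B t) (hn : W.IsContravariant n) {α β : G}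
    (hα : α ∈ W.suppG n) (hβ : β ∈ B) (e : src β = rng α) :
    β * α ∈ W.suppG (W.conv (W.bump B t) n) := by
  obtain ⟨a, ha, rfl⟩ := hα
  have e' : src (W.sec β) = rng a := by rw [W.src_eq_rng_iff, q_sec, e]
  refine ⟨W.sec β * a, ?_, by rw [W.q_mul_of_eq e', q_sec]⟩
  rw [Function.mem_support, conv_eq_single h.isContravariant hn (rng_mul_eq e').symm,
    inv_mul_cancel_left_of_eq e', bump_apply ((q_sec (W := W) β).symm ▸ hβ)]
  · exact fun h0 => ha ((Units.mul_right_eq_zero _).mp h0)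
  · intro c hc hb _
    refine h.isOpenBisection.injOn_rng (q_mem_of_bump_ne_zero hb)
      ((q_sec (W := W) β).symm ▸ hβ) ?_
    rw [← W.rng_eq_rng_iff, hc, rng_mul_eq e']

/-- For a bisection, `B B⁻¹` consists of units. -/
theorem conv_mem_diagonal [T2Space G] (h : W.IsChart B t) (hf : f ∈ W.steinbergAlgebra)
    (hg : g ∈ W.steinbergAlgebra) (hfB : W.suppG f ⊆ B)
    (hgB : W.suppG g ⊆ (fun α => α⁻¹) ⁻¹' B) : W.conv f g ∈ W.diagonal := by
  refine ⟨conv_mem hf hg, fun c hc => ?_⟩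
  obtain ⟨α, hα, β, hβ, e, rfl⟩ := suppG_conv_subset hc
  have h1 : α = β⁻¹ := h.isOpenBisection.injOn_src (hfB hα) (hgB hβ) (by rw [src_inv, e])
  rw [h1]
  exact src_mem β

/-- The product of the bump and its inverse bump is diagonal, with value `t(a)⁻¹ t(a) = 1` at `r(a)`
for `a` over `B`, so it acts as a left identity on the bump. -/
theorem conv_conv_bump [T2Space G] (h : W.IsChart B t) :
    W.conv (W.conv (W.bump B t) (W.bump ((fun α => α⁻¹) ⁻¹' B) fun a => (t a⁻¹)⁻¹))
      (W.bump B t) = W.bump B t := by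
  have hd := h.conv_mem_diagonal h.bump_mem h.inv.bump_mem suppG_bump_subset suppG_bump_subset
  funext a
  rw [conv_diagonal_left hd.1.2.1 hd.2 h.isContravariant]
  by_cases ha : W.q a ∈ B
  · have ha' : W.q a⁻¹ ∈ (fun α => α⁻¹) ⁻¹' B := by
      rw [mem_preimage, W.q_inv, inv_inv']
      exact ha
    have h1 : a⁻¹ * rng a = a⁻¹ := by rw [← src_inv, mul_src]
    rw [conv_eq_single (c := a) h.isContravariant h.inv.isContravariant (rng_rng a).symm, h1,
      bump_apply ha, bump_apply ha', inv_inv', inv_inv, Units.inv_mul, one_mul]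
    intro c hc hbc _
    refine h.isOpenBisection.injOn_rng (q_mem_of_bump_ne_zero hbc) ha ?_
    rw [← W.rng_eq_rng_iff, hc, rng_rng]
  · have h1 : W.bump B t a = 0 := by_contra fun h' => ha (q_mem_of_bump_ne_zero h')
    rw [h1, mul_zero]

end IsChart

/-- Inverting a chart twice returns the same bump, so each fact about a chart also yields its mirror
image. -/
theorem bump_inv_inv : (W.bump ((fun α => α⁻¹) ⁻¹' ((fun α => α⁻¹) ⁻¹' B))
    fun a => ((t (a⁻¹)⁻¹)⁻¹)⁻¹) = W.bump B t := by
  simp only [← preimage_comp, Function.comp_def, inv_inv', inv_inv, preimage_id']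

variable [T2Space G]

/-- Convolution makes the twisted Steinberg algebra a semigroup. -/
noncomputable instance : Semigroup W.steinbergAlgebra where
  mul f g := ⟨W.conv f g, conv_mem f.2 g.2⟩
  mul_assoc f g h := Subtype.ext (conv_assoc f.2 g.2 h.2)

variable (W) in
/-- The diagonal, as a subset of the twisted Steinberg algebra. -/
def diagonalSet : Set W.steinbergAlgebra := {f | (f : S → R) ∈ W.diagonal}

theorem diagonalSet_comm : ∀ x ∈ W.diagonalSet, ∀ y ∈ W.diagonalSet, x * y = y * x :=
  fun _ hx _ hy => Subtype.ext (conv_diagonal_comm hx hy)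

/-- The set `r(supp n)` is compact and open, and the bump of its unit chart takes the value `1` at
the units of the twist over it. -/
theorem exists_local_unit (n : W.steinbergAlgebra) : ∃ e ∈ W.diagonalSet, e * n = n := by
  obtain ⟨t, ht, ht1⟩ := exists_unit_chart (W := W) (n.2.2.2.image continuous_rng)
    (isOpenMap_rng _ (isOpen_suppG n.2.1)) (by rintro _ ⟨a, _, rfl⟩; exact rng_mem a)
  have hs : W.suppG (W.bump (rng '' W.suppG n) t) ⊆ unitSpace G :=
    suppG_bump_subset.trans (by rintro _ ⟨a, _, rfl⟩; exact rng_mem a)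
  refine ⟨⟨_, ht.bump_mem⟩, ⟨ht.bump_mem, hs⟩, Subtype.ext (funext fun a => ?_)⟩
  refine (conv_diagonal_left ht.isContravariant hs n.2.2.1 a).trans ?_
  by_cases ha : (n : S → R) a = 0
  · rw [ha, mul_zero]
  · rw [bump_apply, ht1 _ (rng_mem a), inv_one, Units.val_one, one_mul]
    rw [W.q_rng]
    exact mem_image_of_mem _ (mem_image_of_mem _ ha)

/-- With a diagonal local unit `e` satisfying `e n = n`, the product `m n = m e n` is a conjugate of
a diagonal element; `n m` is treated likewise. -/
theorem IsNormaliser.exists_pair {n : S → R} (hn : W.IsNormaliser n) :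
    ∃ m, IsNormaliserPair W.diagonalSet ⟨n, hn.1⟩ m := by
  obtain ⟨hnA, m, hm, h1, h2, h3, h4⟩ := hn
  refine ⟨⟨m, hm⟩, Subtype.ext h1, Subtype.ext h2, fun f hf => h3 f hf, fun f hf => h4 f hf, ?_, ?_⟩
  · obtain ⟨e, he, hen⟩ := exists_local_unit (W := W) ⟨n, hnA⟩
    rw [← hen, ← mul_assoc]
    exact h3 e he
  · obtain ⟨e, he, hen⟩ := exists_local_unit (W := W) ⟨m, hm⟩
    rw [← hen, ← mul_assoc]
    exact h4 e he

theorem IsChart.conj_bump (h : W.IsChart B t) (hf : f ∈ W.diagonal) :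
    W.conv (W.conv (W.bump B t) f) (W.bump ((fun α => α⁻¹) ⁻¹' B) fun a => (t a⁻¹)⁻¹) ∈
      W.diagonal :=
  h.conv_mem_diagonal (conv_mem h.bump_mem hf.1) h.inv.bump_mem
    ((suppG_conv_diagonal_subset hf h.isContravariant).trans suppG_bump_subset) suppG_bump_subset

theorem IsChart.normaliserPair (h : W.IsChart B t) :
    IsNormaliserPair W.diagonalSet ⟨W.bump B t, h.bump_mem⟩ ⟨_, h.inv.bump_mem⟩ where
  mul_mul_right := by
    have h1 := h.inv.conv_conv_bump
    rw [bump_inv_inv] at h1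
    exact Subtype.ext h1
  mul_mul_left := Subtype.ext h.conv_conv_bump
  conj_right f hf := by
    have h1 := h.inv.conj_bump hf
    rw [bump_inv_inv] at h1
    exact h1
  conj_left f hf := h.conj_bump hf
  mul_mem_right := by
    have h1 := h.inv.conv_mem_diagonal h.inv.bump_mem h.inv.inv.bump_mem suppG_bump_subset
      suppG_bump_subset
    rw [bump_inv_inv] at h1
    exact h1
  mul_mem_left := h.conv_mem_diagonal h.bump_mem h.inv.bump_mem suppG_bump_subset suppG_bump_subset

end Ample

end DiscreteTwist

namespace GradedDiscreteTwist

/-! ### Restriction to degree `ε` -/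

section Restriction

variable {R Γ S G : Type*} [CommRing R] [Group Γ] [TopologicalSpace Γ]
    [TopologicalSpace S] [ArrowGroupoid S] [IsTopologicalGroupoid S]
    [TopologicalSpace G] [ArrowGroupoid G] [IsTopologicalGroupoid G]
    {W : GradedDiscreteTwist R Γ S G} {f g : S → R}

theorem q_mem_fibre_iff {a : S} : W.q a ∈ W.cG.fibre 1 ↔ a ∈ W.cS.fibre 1 := by
  change W.cG.toFun _ = 1 ↔ W.cS.toFun a = 1
  rw [W.comm]

theorem suppG_conv_subset_fibre {f g : S → R} {γ δ : Γ} (hf : W.suppG f ⊆ W.cG.fibre γ)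
    (hg : W.suppG g ⊆ W.cG.fibre δ) : W.suppG (W.conv f g) ⊆ W.cG.fibre (γ * δ) := by
  intro c hc
  obtain ⟨α, hα, β, hβ, e, rfl⟩ := DiscreteTwist.suppG_conv_subset hc
  have h1 : W.cG.toFun α = γ := hf hα
  have h2 : W.cG.toFun β = δ := hg hβ
  change W.cG.toFun _ = _
  rw [W.cG.map_mul' (composable_iff.mpr e), h1, h2]

theorem diagonal_subset_fibre {f : S → R} (hf : f ∈ W.diagonal) :
    W.suppG f ⊆ W.cG.fibre 1 := fun _ hα => W.cG.map_unit (hf.2 hα)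

variable (W) in
/-- Restriction of functions to the arrows of degree `ε`. -/
def res (f : S → R) : W.cS.fibre 1 → R := fun a => f a

variable [DiscreteTopology Γ]

theorem isClopen_fibre {X : Type*} [TopologicalSpace X] [ArrowGroupoid X] (c : Grading X Γ)
    (γ : Γ) : IsClopen (c.fibre γ) :=
  (isClopen_discrete {γ}).preimage c.continuous_toFun

theorem coe_identityTwist_act (t : Rˣ) (a : W.cS.fibre 1) :
    (W.identityTwist.act t a : S) = W.act t (a : S) := by
  have e : W.unitIncl (rngU (W.identityTwist.q a)) = rngU (W.q (a : S)) := W.unitIncl_rngU _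
  have h : Composable (W.i (W.unitIncl (rngU (W.identityTwist.q a)), t)) (a : S) := by
    rw [e]
    exact W.composable_i_rng a t
  refine (W.cS.coe_mul (a := W.identityTwist.i (rngU (W.identityTwist.q a), t)) h).trans ?_
  change W.i (W.unitIncl (rngU (W.identityTwist.q a)), t) * (a : S) = _
  rw [e, DiscreteTwist.act]

theorem isContravariant_res (hf : W.IsContravariant f) :
    W.identityTwist.IsContravariant (W.res f) := by
  intro t a
  change f _ = _ * f _
  rw [coe_identityTwist_act, hf]

theorem suppG_res : W.identityTwist.suppG (W.res f) = Subtype.val ⁻¹' W.suppG f := by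
  ext α
  constructor
  · rintro ⟨a, ha, rfl⟩
    exact ⟨a, ha, rfl⟩
  · rintro ⟨a, ha, hα⟩
    exact ⟨⟨a, q_mem_fibre_iff.mp (hα ▸ α.2)⟩, ha, Subtype.ext hα⟩

theorem res_mem (hf : f ∈ W.steinbergAlgebra) : W.res f ∈ W.identityTwist.steinbergAlgebra := by
  refine ⟨hf.1.comp_continuous continuous_subtype_val, isContravariant_res hf.2.1, ?_⟩
  rw [suppG_res]
  exact (isClopen_fibre W.cG 1).isClosed.isClosedEmbedding_subtypeVal.isCompact_preimage hf.2.2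

theorem res_mem_diagonal (hf : f ∈ W.diagonal) : W.res f ∈ W.identityTwist.diagonal := by
  refine ⟨res_mem hf.1, ?_⟩
  rw [suppG_res]
  exact fun α hα => (W.cG.mem_unitSpace_iff α).mpr (hf.2 hα)

/-- Extension by zero stays locally constant because `Σ_ε` is clopen. Thus conjugating diagonal
elements of the restricted twist reduces to conjugating those of `C`. -/
theorem exists_res_eq {d : W.cS.fibre 1 → R} (hd : d ∈ W.identityTwist.diagonal) :
    ∃ f ∈ W.diagonal, W.res f = d := by
  classical
  have hcl := isClopen_fibre W.cS 1
  let f : S → R := fun a => if h : a ∈ W.cS.fibre 1 then d ⟨a, h⟩ else 0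
  have hf1 : ∀ a : W.cS.fibre 1, f a = d a := fun a => dif_pos a.2
  have hf0 : ∀ a, a ∉ W.cS.fibre 1 → f a = 0 := fun a ha => dif_neg ha
  have hmem : ∀ a, f a ≠ 0 → a ∈ W.cS.fibre 1 := fun a ha => by_contra fun h => ha (hf0 a h)
  have hl : IsLocallyConstant f := by
    rw [IsLocallyConstant.iff_eventually_eq]
    intro a
    by_cases ha : a ∈ W.cS.fibre 1
    · have h1 := (IsLocallyConstant.iff_eventually_eq d).mp hd.1.1 ⟨a, ha⟩
      change ∀ᶠ b in 𝓝 ((⟨a, ha⟩ : W.cS.fibre 1) : S), f b = f (⟨a, ha⟩ : W.cS.fibre 1)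
      rw [← hcl.isOpen.isOpenEmbedding_subtypeVal.map_nhds_eq, Filter.eventually_map]
      filter_upwards [h1] with b hb
      exact (hf1 b).trans (hb.trans (hf1 _).symm)
    · filter_upwards [hcl.compl.isOpen.mem_nhds ha] with b hb
      rw [hf0 b hb, hf0 a ha]
  have hc : W.IsContravariant f := by
    intro t a
    by_cases ha : a ∈ W.cS.fibre 1
    · have h1 := hd.1.2.1 t ⟨a, ha⟩
      rw [← hf1, ← hf1, coe_identityTwist_act] at h1
      exact h1
    · have h1 : W.act t a ∉ W.cS.fibre 1 := fun h => ha (by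
        rwa [← q_mem_fibre_iff, W.q_act, q_mem_fibre_iff] at h)
      rw [hf0 a ha, hf0 _ h1, mul_zero]
  have hs : W.suppG f = Subtype.val '' W.identityTwist.suppG d := by
    ext α
    constructor
    · rintro ⟨a, ha, rfl⟩
      exact ⟨_, ⟨⟨a, hmem a ha⟩, fun h => ha ((hf1 ⟨a, hmem a ha⟩).trans h), rfl⟩, rfl⟩
    · rintro ⟨_, ⟨a, ha, rfl⟩, rfl⟩
      exact ⟨a, fun h => ha ((hf1 a).symm.trans h), rfl⟩
  refine ⟨f, ⟨⟨hl, hc, ?_⟩, ?_⟩, funext hf1⟩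
  · rw [hs]
    exact hd.1.2.2.image continuous_subtype_val
  · rw [hs]
    rintro _ ⟨α, hα, rfl⟩
    exact (W.cG.mem_unitSpace_iff α).mp (hd.2 hα)

/-- At a point of degree `ε` the two factors of a nonzero term have mutually inverse degrees. If one
factor is supported in degree `ε`, only arrows of `G_ε` contribute. -/
theorem res_conv (hf : W.IsContravariant f) (hg : W.IsContravariant g)
    (h : W.suppG f ⊆ W.cG.fibre 1 ∨ W.suppG g ⊆ W.cG.fibre 1) :
    W.res (W.conv f g) = W.identityTwist.conv (W.res f) (W.res g) := by
  funext a
  change W.conv f g (a : S) = _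
  have ha : W.cS.toFun (a : S) = 1 := a.2
  rw [DiscreteTwist.conv_eq_finsum rfl, DiscreteTwist.conv_eq_finsum rfl]
  let j : {α : W.cG.fibre 1 // rng α = rng (W.identityTwist.q a)} →
      {α : G // rng α = rng (W.q (a : S))} := fun α => ⟨((α : W.cG.fibre 1) : G), by
    have h1 := congrArg Subtype.val α.2
    rwa [W.cG.coe_rng, W.cG.coe_rng] at h1⟩
  have hj : Function.Injective j := fun α β e =>
    Subtype.ext (Subtype.ext (Subtype.mk.inj e))
  have hterm : ∀ α, f (W.sec (j α)) * g ((W.sec (j α))⁻¹ * a) =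
      W.res f (W.identityTwist.sec α) *
        W.res g ((W.identityTwist.sec (α : W.cG.fibre 1))⁻¹ * a) := by
    intro α
    have hr := DiscreteTwist.rng_sec (W := W.identityTwist) α.2
    have hr' : rng ((W.identityTwist.sec (α : W.cG.fibre 1) : W.cS.fibre 1) : S) = rng (a : S) := by
      have h1 := congrArg Subtype.val hr
      rwa [W.cS.coe_rng, W.cS.coe_rng] at h1
    have hq : W.q (W.sec (j α)) = W.q (W.identityTwist.sec (α : W.cG.fibre 1) : W.cS.fibre 1) :=
      (DiscreteTwist.q_sec _).trans
        (congrArg Subtype.val (DiscreteTwist.q_sec (W := W.identityTwist) α.1)).symm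
    have h1 := hf.mul_eq hg hq (DiscreteTwist.rng_sec (j α).2)
    rw [h1]
    change _ = f _ * g _
    rw [W.cS.coe_mul, W.cS.coe_inv]
    rw [W.cS.coe_inv, composable_iff, src_inv, hr']
  rw [← finsum_congr hterm, ← finsum_mem_range (f := fun α : {α : G // rng α = rng (W.q (a : S))} =>
    f (W.sec α) * g ((W.sec α)⁻¹ * a)) hj, ← finsum_mem_univ]
  refine finsum_mem_inter_support_eq' _ _ _ fun α hα => ?_
  refine ⟨fun _ => ?_, fun _ => mem_univ _⟩
  have hα1 : (α : G) ∈ W.cG.fibre 1 := by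
    rcases h with h | h
    · have h1 := h (mem_image_of_mem _ (left_ne_zero_of_mul hα))
      rwa [DiscreteTwist.q_sec] at h1
    · have h1 := h (mem_image_of_mem _ (right_ne_zero_of_mul hα))
      have hc : Composable (W.sec (α : G))⁻¹ (a : S) := by
        rw [composable_iff, src_inv, DiscreteTwist.rng_sec α.2]
      have h2 : W.cG.toFun (W.q ((W.sec (α : G))⁻¹ * a)) = 1 := h1
      rw [W.comm, W.cS.map_mul' hc, ha, mul_one, W.cS.map_inv, inv_eq_one, ← W.comm,
        DiscreteTwist.q_sec] at h2
      exact h2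
  exact ⟨⟨⟨α, hα1⟩, Subtype.ext (by rw [W.cG.coe_rng, W.cG.coe_rng]; exact α.2)⟩, rfl⟩

end Restriction

/-! ### Normalisers of degree `ε` and the local bisection hypothesis -/

section Ample

variable {R Γ S G : Type*} [CommRing R] [Group Γ] [TopologicalSpace Γ] [DiscreteTopology Γ]
    [TopologicalSpace S] [ArrowGroupoid S] [IsTopologicalGroupoid S]
    [TopologicalSpace G] [ArrowGroupoid G] [IsAmple G]
    {W : GradedDiscreteTwist R Γ S G}

theorem exists_chart_inv {α : G} {γ : Γ} (hα : α ∈ W.cG.fibre γ) :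
    ∃ (B : Set G) (t : S → Rˣ), W.IsChart B t ∧ α⁻¹ ∈ B ∧ B ⊆ W.cG.fibre γ⁻¹ := by
  refine DiscreteTwist.exists_chart (W := W.toDiscreteTwist)
    (isClopen_fibre W.cG γ⁻¹).isOpen ?_
  change W.cG.toFun _ = _
  rw [W.cG.map_inv, show W.cG.toFun α = γ from hα]

variable [T2Space G]

/-- The quasi-inverse `p` may have components in other degrees. Still, each product in the
normaliser identities, bracketed as they are, has a factor supported in degree `ε`: `k`, a diagonal
element such as `p k`, or a product of `k` with diagonal elements or with `p` next to `k`. So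
`res_conv` always applies. -/
theorem isNormaliser_res {k p : W.steinbergAlgebra}
    (h : IsNormaliserPair W.toDiscreteTwist.diagonalSet k p)
    (hk : W.suppG (k : S → R) ⊆ W.cG.fibre 1) : W.identityTwist.IsNormaliser (W.res k) := by
  have hmul : ∀ x y : W.steinbergAlgebra,
      W.suppG (x : S → R) ⊆ W.cG.fibre 1 ∨ W.suppG (y : S → R) ⊆ W.cG.fibre 1 →
      W.identityTwist.conv (W.res x) (W.res y) = W.res (x * y : W.steinbergAlgebra) :=
    fun x y hxy => (res_conv x.2.2.1 y.2.2.1 hxy).symm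
  refine ⟨res_mem k.2, W.res p, res_mem p.2, ?_, ?_, fun d hd => ?_, fun d hd => ?_⟩
  · rw [hmul p k (Or.inr hk), hmul (p * k) p (Or.inl (diagonal_subset_fibre h.mul_mem_right)),
      h.mul_mul_right]
  · rw [hmul k p (Or.inl hk), hmul (k * p) k (Or.inr hk), h.mul_mul_left]
  · obtain ⟨f, hf, rfl⟩ := exists_res_eq hd
    rw [hmul p ⟨f, hf.1⟩ (Or.inr (diagonal_subset_fibre hf)), hmul (p * ⟨f, hf.1⟩) k (Or.inr hk)]
    exact res_mem_diagonal (h.conj_right ⟨f, hf.1⟩ hf)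
  · obtain ⟨f, hf, rfl⟩ := exists_res_eq hd
    have hkf : W.suppG ((k * ⟨f, hf.1⟩ : W.steinbergAlgebra) : S → R) ⊆ W.cG.fibre 1 := by
      have h1 := suppG_conv_subset_fibre hk (diagonal_subset_fibre hf)
      rwa [mul_one] at h1
    rw [hmul k ⟨f, hf.1⟩ (Or.inl hk), hmul (k * ⟨f, hf.1⟩) p (Or.inl hkf)]
    exact res_mem_diagonal (h.conj_left ⟨f, hf.1⟩ hf)

/-- Under the local bisection hypothesis in degree `ε`, the range and source maps are injective on
the support of a normaliser of degree `ε`. -/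
theorem injOn_suppG (hW : W.identityTwist.LocalBisectionHypothesis) {k p : W.steinbergAlgebra}
    (h : IsNormaliserPair W.toDiscreteTwist.diagonalSet k p)
    (hk : W.suppG (k : S → R) ⊆ W.cG.fibre 1) :
    InjOn rng (W.suppG (k : S → R)) ∧ InjOn src (W.suppG (k : S → R)) := by
  have hB := hW _ (isNormaliser_res h hk)
  rw [suppG_res] at hB
  constructor
  · intro α hα β hβ e
    exact congrArg Subtype.val (hB.injOn_rng (x₁ := ⟨α, hk hα⟩) (x₂ := ⟨β, hk hβ⟩) hα hβ
      (Subtype.ext (by rw [W.cG.coe_rng, W.cG.coe_rng]; exact e)))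
  · intro α hα β hβ e
    exact congrArg Subtype.val (hB.injOn_src (x₁ := ⟨α, hk hα⟩) (x₂ := ⟨β, hk hβ⟩) hα hβ
      (Subtype.ext (by rw [W.cG.coe_src, W.cG.coe_src]; exact e)))

end Ample

end GradedDiscreteTwist

theorem mainTheorem8 {R Γ S G : Type*} [CommRing R]
    [Group Γ] [TopologicalSpace Γ] [DiscreteTopology Γ]
    [TopologicalSpace S] [ArrowGroupoid S] [IsTopologicalGroupoid S]
    [TopologicalSpace G] [ArrowGroupoid G] [IsAmple G] [T2Space G]
    (W : GradedDiscreteTwist R Γ S G)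
    (hW : W.identityTwist.LocalBisectionHypothesis)
    (n : S → R) (hn : W.IsHomogeneousNormaliser n) :
    IsOpenBisection (W.suppG n) := by
  obtain ⟨hn, γ, hnA, hγ⟩ := hn
  obtain ⟨m, hm⟩ := hn.exists_pair
  have hC := DiscreteTwist.diagonalSet_comm (W := W.toDiscreteTwist)
  refine isOpenBisection_of_injOn (DiscreteTwist.isOpen_suppG hnA.1) ?_ ?_
  · intro α hα β hβ e
    obtain ⟨B, t, hB, hαB, hBγ⟩ := GradedDiscreteTwist.exists_chart_inv (hγ hα)
    have h1 := GradedDiscreteTwist.suppG_conv_subset_fibre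
      ((DiscreteTwist.suppG_bump_subset (t := t)).trans hBγ) hγ
    -- The bump has degree `γ⁻¹`, so its product with `n` has degree `ε`.
    rw [inv_mul_cancel] at h1
    have e1 : src α⁻¹ = rng β := (src_inv α).trans e
    -- Both `α⁻¹α` and `α⁻¹β` lie in the support of that product and have range `s(α)`; the
    -- hypothesis identifies them, and `α⁻¹` cancels.
    refine (mul_left_cancel_of_eq (src_inv α) e1
      ((GradedDiscreteTwist.injOn_suppG hW (hB.normaliserPair.mul hC hm) h1).1
        (hB.mul_mem_suppG_left hnA.2.1 hα hαB (src_inv α))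
        (hB.mul_mem_suppG_left hnA.2.1 hβ hαB e1) ?_))
    rw [rng_mul_eq (src_inv α), rng_mul_eq e1]
  · intro α hα β hβ e
    obtain ⟨B, t, hB, hαB, hBγ⟩ := GradedDiscreteTwist.exists_chart_inv (hγ hα)
    have h1 := GradedDiscreteTwist.suppG_conv_subset_fibre hγ
      ((DiscreteTwist.suppG_bump_subset (t := t)).trans hBγ)
    rw [mul_inv_cancel] at h1
    have e0 : src α = rng α⁻¹ := (rng_inv α).symm
    have e1 : src β = rng α⁻¹ := e.symm.trans e0
    -- The mirror argument: `αα⁻¹` and `βα⁻¹` have the same source.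
    refine (mul_right_cancel_of_eq e0 e1
      ((GradedDiscreteTwist.injOn_suppG hW (hm.mul hC hB.normaliserPair) h1).2
        (hB.mul_mem_suppG_right hnA.2.1 hα hαB e0)
        (hB.mul_mem_suppG_right hnA.2.1 hβ hαB e1) ?_))
    rw [src_mul_eq e0, src_mul_eq e1]
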